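/- Let $f_1,\dots,f_k\in\mathbb{C}[p_0,\dots,p_n]$ be homogeneous polynomials defining an irreducible, generically reduced $X\subset\mathbb{P}^n$, and let $X'\subset\mathbb{P}^{n+1}$, with coordinates $p_0,\dots,p_n,p_s$, be defined by $f_1,\dots,f_k$ and $p_s-p_0-\dots-p_n$. Let $N_{X'}\subset\mathbb{P}^{n+1}\times\mathbb{P}^{n+1}$ be the Zariski closure of $\{(p,b): p\in X'_{reg},\ b\perp T_pX'\}$, and let the dual variety $X'^*$, with coordinates $b_0,\dots,b_n,b_s$, be the projection of $N_{X'}$ to the second factor. For data $u\in(\mathbb{C}^*)^{n+1}$ with $u_+:=u_0+\dots+u_n\neq 0$, put $$l'_u(x)=x_0^{u_0}\cdots x_n^{u_n}x_s^{-u_+}.$$ For $Y=X'$ or $Y=X'^*$, a critical point of $l'_u$ on $Y$ is a regular point $x$ of $Y$ with all coordinates nonzero such that the gradient $[u_0/x_0:\dots:u_n/x_n:-u_+/x_s]$ of $l'_u$ at $x$ is orthogonal to the tangent space $T_xY$. For $p\in X'$ and $b\in X'^*$ consider the relation $$[p_0b_0:\dots:p_nb_n:p_sb_s]=[u_0:\dots:u_n:-u_+].\qquad(*)$$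 (1) For generic $u$ (all $u$ as above outside the zero set of some nonzero polynomial in $u_0,\dots,u_n$ that depends only on the $f_j$), the relation $(*)$ is the graph of a bijection between the critical points of $l'_u(p)$ on $X'$ and the critical points of $l'_u(b)$ on $X'^*$. (2) For every $u$ as above: if $p\in X'_{reg}$ and $b\in (X'^*)_{reg}$ satisfy $(*)$, then $p$ is a critical point of $l'_u(p)$ on $X'$ if and only if $b$ is a critical point of $l'_u(b)$ on $X'^*$. (3) For every $u$ as above and all critical points $p$ of $l'_u(p)$ on $X'$ and $b$ of $l'_u(b)$ on $X'^*$ that satisfy $(*)$, the product is the constant $$l'_u(p)\,l'_u(b)=u_0^{u_0}\cdots u_n^{u_n}(-u_+)^{-u_+}.$$ For integer data this is an equality of numbers. For complex $u$ it is an equality of sets of values of multivalued functions: a monomial $x^w$ takes the values $\exp(\sum_i w_i\alpha_i)$ for all choices of logarithms $\alpha_i$ of the $x_i$. -/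

import Mathlib

open scoped LinearAlgebra.Projectivization

noncomputable section

namespace MLDual

variable {σ : Type} [Fintype σ]

/-- The complex projective space with homogeneous coordinates indexed by `σ`. It is also used as
the dual projective space, a point `q` of which is the hyperplane `∑ i, q i * x i = 0`. -/
abbrev PSpace (σ : Type) : Type := ℙ ℂ (σ → ℂ)

/-- The polynomial `f` is homogeneous of some degree. -/
def IsHomog (f : MvPolynomial σ ℂ) : Prop := ∃ d : ℕ, f.IsHomogeneous d

/-- The projective zero locus of a set of homogeneous polynomials (for a homogeneous polynomial the
choice of homogeneous coordinates of the point is irrelevant). -/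
def zeroLocus (S : Set (MvPolynomial σ ℂ)) : Set (PSpace σ) :=
  {p | ∀ f ∈ S, MvPolynomial.eval p.rep f = 0}

/-- The homogeneous polynomials that vanish on a set of points of projective space. They generate
the homogeneous vanishing ideal, and their zero locus is the Zariski closure of the set. -/
def vanishingForms (Y : Set (PSpace σ)) : Set (MvPolynomial σ ℂ) :=
  {f | IsHomog f ∧ ∀ p ∈ Y, MvPolynomial.eval p.rep f = 0}

/-- Zariski closed subsets of projective space. -/
def IsZariskiClosed (Y : Set (PSpace σ)) : Prop :=
  ∃ S : Set (MvPolynomial σ ℂ), (∀ f ∈ S, IsHomog f) ∧ Y = zeroLocus S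

/-- Irreducibility in the Zariski topology: nonempty, and not covered by two closed sets neither of
which contains it. -/
def IsIrred (Y : Set (PSpace σ)) : Prop :=
  Y.Nonempty ∧ ∀ A B : Set (PSpace σ), IsZariskiClosed A → IsZariskiClosed B →
    Y ⊆ A ∪ B → Y ⊆ A ∨ Y ⊆ B

/-- The scheme defined by the homogeneous polynomials `S` (with irreducible zero locus) is
generically reduced: on some nonempty open subset `g ≠ 0` of it, every form that vanishes on the
zero locus lies in the (localized) ideal generated by `S`. -/
def IsGenericallyReduced (S : Set (MvPolynomial σ ℂ)) : Prop :=
  ∃ g : MvPolynomial σ ℂ, IsHomog g ∧ (∃ p ∈ zeroLocus S, MvPolynomial.eval p.rep g ≠ 0) ∧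
    ∀ h ∈ vanishingForms (zeroLocus S), g * h ∈ Ideal.span S

/-- The tangent space at `p` of the projective scheme defined by the homogeneous polynomials `S`,
as a linear subspace of the affine space (that is, the tangent space of the affine cone): the
kernel of the Jacobian matrix of `S` at `p`. -/
def tangentSpace (S : Set (MvPolynomial σ ℂ)) (p : PSpace σ) : Submodule ℂ (σ → ℂ) where
  carrier := {t | ∀ f ∈ S, ∑ i, MvPolynomial.eval p.rep (MvPolynomial.pderiv i f) * t i = 0}
  zero_mem' := by
    intro f _
    simp
  add_mem' := by
    intro a b ha hb f hf
    simp only [Pi.add_apply, mul_add, Finset.sum_add_distrib]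
    rw [ha f hf, hb f hf, add_zero]
  smul_mem' := by
    intro c a ha f hf
    have h : ∑ i, MvPolynomial.eval p.rep (MvPolynomial.pderiv i f) * (c • a) i
        = c * ∑ i, MvPolynomial.eval p.rep (MvPolynomial.pderiv i f) * a i := by
      rw [Finset.mul_sum]
      refine Finset.sum_congr rfl fun i _ => ?_
      simp only [Pi.smul_apply, smul_eq_mul]
      ring
    rw [h, ha f hf, mul_zero]

/-- `p` is a regular point of the (irreducible) variety defined by the homogeneous polynomials `S`:
the dimension of the tangent space is that of the variety. Both dimensions are those of the affine
cone; equivalently, the rank of the Jacobian matrix at `p` is the codimension. -/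
def IsRegularPoint (S : Set (MvPolynomial σ ℂ)) (p : PSpace σ) : Prop :=
  p ∈ zeroLocus S ∧
    ((Module.finrank ℂ (tangentSpace S p) : ℕ) : WithBot ℕ∞) =
      ringKrullDim (MvPolynomial σ ℂ ⧸ Ideal.span S)

/-- The vector `v` is orthogonal to the tangent space at `p`, for the bilinear (not Hermitian)
pairing `∑ i, v i * t i`. -/
def PerpTangent (S : Set (MvPolynomial σ ℂ)) (p : PSpace σ) (v : σ → ℂ) : Prop :=
  ∀ t ∈ tangentSpace S p, ∑ i, v i * t i = 0

/-- Bihomogeneous polynomials in two groups of variables, both indexed by `σ`. -/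
def IsBihomog (F : MvPolynomial (σ ⊕ σ) ℂ) : Prop :=
  ∃ d e : ℕ, MvPolynomial.IsWeightedHomogeneous
    (Sum.elim (fun _ => ((1, 0) : ℕ × ℕ)) (fun _ => ((0, 1) : ℕ × ℕ))) F (d, e)

/-- Zariski closure in the product of two projective spaces. -/
def biClosure (Z : Set (PSpace σ × PSpace σ)) : Set (PSpace σ × PSpace σ) :=
  {z | ∀ F : MvPolynomial (σ ⊕ σ) ℂ, IsBihomog F →
    (∀ y ∈ Z, MvPolynomial.eval (Sum.elim y.1.rep y.2.rep) F = 0) →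
    MvPolynomial.eval (Sum.elim z.1.rep z.2.rep) F = 0}

/-- The conormal variety: the Zariski closure of the set of pairs `(p, q)` where `p` is a regular
point and `q` is orthogonal to the tangent space at `p`. -/
def conormalVariety (S : Set (MvPolynomial σ ℂ)) : Set (PSpace σ × PSpace σ) :=
  biClosure {z | IsRegularPoint S z.1 ∧ PerpTangent S z.1 z.2.rep}

/-- The dual variety: the projection of the conormal variety to the dual projective space. -/
def dualVariety (S : Set (MvPolynomial σ ℂ)) : Set (PSpace σ) :=
  Prod.snd '' conormalVariety S

/-- The defining equations of the dual variety: all homogeneous polynomials vanishing on it. -/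
def dualEquations (S : Set (MvPolynomial σ ℂ)) : Set (MvPolynomial σ ℂ) :=
  vanishingForms (dualVariety S)

/-- `p` is a critical point of the monomial `∏ i, x i ^ w i` (complex exponents) on the variety
defined by `S`: a regular point with nonzero coordinates at which the gradient, which is
`(w i / p i)` up to a nonzero factor, is orthogonal to the tangent space. -/
def IsCriticalPoint (S : Set (MvPolynomial σ ℂ)) (w : σ → ℂ) (p : PSpace σ) : Prop :=
  IsRegularPoint S p ∧ (∀ i, p.rep i ≠ 0) ∧ PerpTangent S p (fun i => w i / p.rep i)

/-- The coordinatewise product of `p` and `b` is `w`, as points of projective space. -/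
def ProductRel (w : σ → ℂ) (p b : PSpace σ) : Prop :=
  ∃ c : ℂ, c ≠ 0 ∧ ∀ i, p.rep i * b.rep i = c * w i

/-- The set of all values of the multivalued monomial `∏ i, x i ^ w i` with complex exponents `w`,
one for each choice of logarithms of the coordinates. If the exponents sum to zero, then it does
not change when `x` is multiplied by a nonzero scalar. -/
def monomialValues (w x : σ → ℂ) : Set ℂ :=
  {z | ∃ α : σ → ℂ, (∀ i, Complex.exp (α i) = x i) ∧ z = Complex.exp (∑ i, w i * α i)}

/-- For every choice `ℓ` of logarithms of the coordinates near `x`, differentiable at `x`, the resulting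
branch of the monomial `∏ i, x i ^ w i` has gradient `(w i / x i)` times its value: this is the
gradient in the definition of critical points. -/
theorem hasFDerivAt_monomial_branch (w x : σ → ℂ) (ℓ : σ → ℂ → ℂ)
    (hd : ∀ i, DifferentiableAt ℂ (ℓ i) (x i))
    (hl : ∀ i, ∀ᶠ z in nhds (x i), Complex.exp (ℓ i z) = z) :
    HasFDerivAt (fun y : σ → ℂ => Complex.exp (∑ i, w i * ℓ i (y i)))
      (Complex.exp (∑ i, w i * ℓ i (x i)) •
        ∑ i, (w i / x i) • (ContinuousLinearMap.proj i : (σ → ℂ) →L[ℂ] ℂ)) x := by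
  have key : ∀ i, HasDerivAt (ℓ i) (1 / x i) (x i) := by
    intro i
    have h1 := (hd i).hasDerivAt
    have h2 := h1.cexp
    have h3 : HasDerivAt (fun z : ℂ => Complex.exp (ℓ i z)) 1 (x i) :=
      (hasDerivAt_id (x i)).congr_of_eventuallyEq (hl i)
    have h4 := h2.unique h3
    rw [(hl i).self_of_nhds] at h4
    have h5 : deriv (ℓ i) (x i) = 1 / x i := by
      have hx : x i ≠ 0 := left_ne_zero_of_mul (by rw [h4]; exact one_ne_zero)
      field_simp
      linear_combination h4
    rwa [h5] at h1
  refine HasFDerivAt.cexp ?_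
  refine HasFDerivAt.fun_sum fun i _ => ?_
  have h6 := ((key i).comp_hasFDerivAt x
    ((ContinuousLinearMap.proj i : (σ → ℂ) →L[ℂ] ℂ).hasFDerivAt)).const_mul (w i)
  rw [smul_smul, mul_one_div] at h6
  exact h6

/-- If `X` in `ℙ^n` is defined by the polynomials `f`, then `X'` in `ℙ^(n+1)` (the last coordinate
is `p_s`) is defined by the same polynomials in the first `n+1` coordinates together with
`H = -p_0 - ⋯ - p_n + p_s`. -/
def primeEquations {n k : ℕ} (f : Fin k → MvPolynomial (Fin (n + 1)) ℂ) :
    Set (MvPolynomial (Fin (n + 2)) ℂ) :=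
  Set.range (fun j => MvPolynomial.rename Fin.castSucc (f j)) ∪
    {MvPolynomial.X (Fin.last (n + 1)) -
      ∑ i : Fin (n + 1), MvPolynomial.X (Fin.castSucc i)}

/-- The exponent vector `(u_0, …, u_n, -u_+)`. -/
def weights {n : ℕ} (u : Fin (n + 1) → ℂ) : Fin (n + 2) → ℂ :=
  Fin.snoc (α := fun _ => ℂ) u (-∑ i, u i)

end MLDual

end

/-! The heart of the matter is reflexivity of conormal varieties. Write `w` for the weights. If `p`
is critical, the vector with entries `w i / p i` is conormal at `p`, and it is the `b` of the
relation. So critical points on either side come from pairs with coordinatewise product `w` in one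
and the same conormal variety. Equivalence at regular pairs is the symmetry of that variety; the
bijection also needs that generic `u` excludes irregular components; in the product formula all
scalings cancel because the weights sum to zero.

Reflexivity is proved at a generic point: a pair `x, y` over a finitely generated extension field of
ℂ (`exists_conormalPair`), with `y` conormal at `x` and, by Euler's formula, `y ⬝ᵥ x = 0`. In
characteristic zero tangent vectors come from derivations (`exists_derivation`). If `t` is tangent
at `y` and `D y = t`, then `0 = D (y ⬝ᵥ x) = t ⬝ᵥ x + y ⬝ᵥ D x`, where the last term vanishes; so
`x` is conormal at `y` (`mem_conormalSpace_symm`). Complex points are treated as specializations of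
the pair: over a regular point these give exactly the conormal vectors
(`CutsOut.specializes_iff_mem_gradSpan`), and the dual variety is the closure of `y`
(`CutsOut.mem_dualEquations_iff`).

For genericity, pairs with an irregular component satisfy an equation `h = 0` that fails at the
generic pair. The `n + 1` products of coordinates, one coordinate of `x`, and `h` are `n + 3`
elements of a field of transcendence degree `n + 2`. Their algebraic relation, together with torus
scaling, yields a nonzero equation in `u` alone (`ConormalPair.exists_forall_eval_mul_eq_zero`). -/

open scoped LinearAlgebra.Projectivization

noncomputable section

namespace MLDual

open MvPolynomial

/-! ### Krull dimension and transcendence degree -/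

section KrullDim

/-- Chains of primes lift along integral extensions. -/
theorem exists_ltSeries_comap {R S : Type*} [CommRing R] [CommRing S] [Algebra R S]
    [Algebra.IsIntegral R S] [FaithfulSMul R S] (l : LTSeries (PrimeSpectrum R)) :
    ∃ L : LTSeries (PrimeSpectrum S), L.length = l.length ∧
      PrimeSpectrum.comap (algebraMap R S) L.last = l.last := by
  induction l using RelSeries.inductionOn' with
  | singleton x =>
    obtain ⟨y, hy⟩ := Algebra.IsIntegral.comap_surjective R S x
    exact ⟨RelSeries.singleton _ y, rfl, by simpa using hy⟩
  | snoc p x hx ih =>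
    obtain ⟨L, hL, hl⟩ := ih
    have hx' : p.last < x := hx
    obtain ⟨Q, hQ, hQp, hQc⟩ := Ideal.exists_ideal_over_prime_of_isIntegral_of_isPrime
      x.asIdeal L.last.asIdeal (by
        have := congrArg PrimeSpectrum.asIdeal hl
        rw [PrimeSpectrum.comap_asIdeal] at this
        rw [this]
        exact hx'.le)
    have hlt : L.last < ⟨Q, hQp⟩ := by
      refine lt_of_le_of_ne hQ fun h => hx'.ne ?_
      rw [← hl, h]
      exact PrimeSpectrum.ext hQc
    refine ⟨L.snoc ⟨Q, hQp⟩ hlt, ?_, ?_⟩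
    · change L.length + 1 = p.length + 1
      rw [hL]
    · simp only [RelSeries.last_snoc]
      exact PrimeSpectrum.ext hQc

/-- Going up lifts chains of primes, and incomparability keeps contracted chains strict. -/
theorem ringKrullDim_eq_of_isIntegral {R S : Type*} [CommRing R] [CommRing S] [Algebra R S]
    [Algebra.IsIntegral R S] [FaithfulSMul R S] : ringKrullDim R = ringKrullDim S := by
  apply le_antisymm
  · refine iSup_le fun l => ?_
    obtain ⟨L, hL, -⟩ := exists_ltSeries_comap (S := S) l
    rw [← hL]
    exact le_iSup (fun l : LTSeries (PrimeSpectrum S) => (l.length : WithBot ℕ∞)) L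
  · refine Order.krullDim_le_of_strictMono (PrimeSpectrum.comap (algebraMap R S)) ?_
    intro I J hIJ
    exact Ideal.IsIntegral.comap_lt_comap (R := R) hIJ

open Algebra in
/-- The Krull dimension of an affine domain is its transcendence degree. -/
theorem exists_ringKrullDim_eq_trdeg (k A : Type) [Field k] [CommRing A] [IsDomain A] [Algebra k A]
    [Algebra.FiniteType k A] :
    ∃ d : ℕ, ringKrullDim A = (d : WithBot ℕ∞) ∧ Algebra.trdeg k A = d := by
  -- Noether normalization reduces both invariants to those of a polynomial ring in `s` variables.
  obtain ⟨s, g, hg, hi⟩ := exists_integral_inj_algHom_of_fg k A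
  refine ⟨s, ?_, ?_⟩
  · let := g.toRingHom.toAlgebra
    have : Algebra.IsIntegral (MvPolynomial (Fin s) k) A := ⟨hi⟩
    have : FaithfulSMul (MvPolynomial (Fin s) k) A :=
      (faithfulSMul_iff_algebraMap_injective _ _).2 hg
    rw [← ringKrullDim_eq_of_isIntegral (R := MvPolynomial (Fin s) k) (S := A)]
    simp [ringKrullDim_eq_zero_of_field]
  · let := g.toRingHom.toAlgebra
    have : Algebra.IsIntegral (MvPolynomial (Fin s) k) A := ⟨hi⟩
    have : FaithfulSMul (MvPolynomial (Fin s) k) A :=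
      (faithfulSMul_iff_algebraMap_injective _ _).2 hg
    have : IsScalarTower k (MvPolynomial (Fin s) k) A :=
      IsScalarTower.of_algebraMap_eq fun r => (g.commutes r).symm
    rw [← trdeg_add_eq k (MvPolynomial (Fin s) k) (A := A),
      trdeg_eq_zero (R := MvPolynomial (Fin s) k) (A := A)]
    simp

end KrullDim

/-! ### Derivations and tangent vectors -/

section Derivations

/-- Applied with `B` the dual numbers over `E`. A bare ring homomorphism `f` is used because the
relevant `A`-structure on `B` is not the standard one. -/
theorem exists_lift_of_formallySmooth {A E B : Type*} [CommRing A] [CommRing E] [CommRing B]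
    [Algebra A E] [Algebra.FormallySmooth A E] (f : A →+* B) (g : B →+* E)
    (hg : Function.Surjective g) (hn : IsNilpotent (RingHom.ker g))
    (hfg : g.comp f = algebraMap A E) :
    ∃ F : E →+* B, F.comp (algebraMap A E) = f ∧ g.comp F = RingHom.id E := by
  let := f.toAlgebra
  let g' : B →ₐ[A] E := { g with commutes' := fun a => RingHom.congr_fun hfg a }
  refine ⟨(Algebra.FormallySmooth.liftOfSurjective (AlgHom.id A E) g' hg hn).toRingHom, ?_, ?_⟩
  · ext a
    exact (Algebra.FormallySmooth.liftOfSurjective (AlgHom.id A E) g' hg hn).commutes a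
  · ext a
    exact Algebra.FormallySmooth.liftOfSurjective_apply (AlgHom.id A E) g' hg hn a

variable {σ : Type} [Fintype σ] {E : Type} [Field E] [Algebra ℂ E]

/-- The gradient of a polynomial at a point with coordinates in a `ℂ`-algebra. -/
def grad {A : Type} [CommRing A] [Algebra ℂ A] (h : MvPolynomial σ ℂ) (x : σ → A) : σ → A :=
  fun i => aeval x (pderiv i h)

/-- The conormal space at a point with coordinates in an extension field of `ℂ`: the span of the
gradients of all polynomials that vanish at the point. -/
def conormalSpace (x : σ → E) : Submodule E (σ → E) :=
  Submodule.span E {v | ∃ h : MvPolynomial σ ℂ, aeval x h = 0 ∧ v = grad h x}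

/-- A bare function `δ` serves two cases: a derivation composed with evaluation, and the second
component of a map to dual numbers. -/
theorem eq_sum_grad_of_leibniz (x : σ → E) (δ : MvPolynomial σ ℂ → E)
    (hadd : ∀ f g, δ (f + g) = δ f + δ g) (hC : ∀ c, δ (C c) = 0)
    (hmul : ∀ f g, δ (f * g) = aeval x f * δ g + aeval x g * δ f) (h : MvPolynomial σ ℂ) :
    δ h = grad h x ⬝ᵥ fun i => δ (X i) := by
  induction h using MvPolynomial.induction_on with
  | C a => simp [hC, grad, dotProduct]
  | add p q hp hq => simp [hadd, hp, hq, grad, dotProduct, add_mul, Finset.sum_add_distrib]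
  | mul_X p i hp =>
    classical
    rw [hmul, hp]
    simp only [grad, dotProduct, Derivation.leibniz, smul_eq_mul, map_add, map_mul, aeval_X,
      add_mul, Finset.sum_add_distrib, pderiv_X, Finset.mul_sum]
    congr 1
    · rw [Finset.sum_eq_single i]
      · simp
      · intro j _ hj
        simp [hj.symm]
      · simp
    · exact Finset.sum_congr rfl fun j _ => by ring

theorem derivation_aeval (D : Derivation ℂ E E) (x : σ → E) (h : MvPolynomial σ ℂ) :
    D (aeval x h) = grad h x ⬝ᵥ fun i => D (x i) := by
  have := eq_sum_grad_of_leibniz x (fun h => D (aeval x h)) (by simp) (by simp) (by simp) h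
  simpa using this

theorem dotProduct_derivation_eq_zero (D : Derivation ℂ E E) (x : σ → E) {v : σ → E}
    (hv : v ∈ conormalSpace x) : (v ⬝ᵥ fun i => D (x i)) = 0 := by
  induction hv using Submodule.span_induction with
  | mem v hv =>
    obtain ⟨h, h0, rfl⟩ := hv
    rw [← derivation_aeval, h0, map_zero]
  | zero => simp
  | add v w _ _ hv hw => rw [add_dotProduct, hv, hw, add_zero]
  | smul a v _ hv => rw [smul_dotProduct, hv, smul_zero]

/-- A tangent vector at a point with coordinates in a finitely generated extension field of `ℂ`
comes from a derivation of that field. -/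
theorem exists_derivation [Algebra.EssFiniteType ℂ E] (x t : σ → E)
    (ht : ∀ v ∈ conormalSpace x, v ⬝ᵥ t = 0) : ∃ D : Derivation ℂ E E, ∀ i, D (x i) = t i := by
  let I := RingHom.ker (aeval x : MvPolynomial σ ℂ →ₐ[ℂ] E)
  let A := MvPolynomial σ ℂ ⧸ I
  have hI : I.IsPrime := RingHom.ker_isPrime _
  let ιA : A →ₐ[ℂ] E := Ideal.Quotient.liftₐ I (aeval x) (fun a ha => ha)
  let : Algebra A E := ιA.toRingHom.toAlgebra
  have hinj : Function.Injective (algebraMap A E) := by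
    rw [injective_iff_map_eq_zero]
    intro a
    obtain ⟨a, rfl⟩ := Ideal.Quotient.mk_surjective a
    intro ha
    exact Ideal.Quotient.eq_zero_iff_mem.2 ha
  have : FaithfulSMul A E := (faithfulSMul_iff_algebraMap_injective _ _).2 hinj
  have : IsScalarTower ℂ A E := IsScalarTower.of_algebraMap_eq fun r => (ιA.commutes r).symm
  let K := FractionRing A
  let : Algebra K E := FractionRing.liftAlgebra A E
  have : IsScalarTower A K E := FractionRing.isScalarTower_liftAlgebra A E
  have : IsScalarTower ℂ K E := IsScalarTower.to₁₃₄ ℂ A K E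
  have : CharZero K := charZero_of_injective_algebraMap (algebraMap ℂ K).injective
  have : Algebra.EssFiniteType K E := Algebra.EssFiniteType.of_comp ℂ K E
  -- Characteristic zero enters here; localization then carries formal smoothness from `K` down to
  -- `A`.
  have : Algebra.FormallySmooth K E := inferInstance
  have : Algebra.FormallySmooth A K := Algebra.FormallySmooth.of_isLocalization (nonZeroDivisors A)
  have : Algebra.FormallySmooth A E := Algebra.FormallySmooth.comp A K E
  -- Evaluation at the first-order point `x + ε t`. Its `ε`-part is the gradient paired with `t`, so
  -- it descends to `A` because `t` annihilates the conormal space.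
  let φ : MvPolynomial σ ℂ →ₐ[ℂ] TrivSqZeroExt E E :=
    aeval fun i => TrivSqZeroExt.inl (x i) + TrivSqZeroExt.inr (t i)
  have hfst : ∀ h, (φ h).fst = aeval x h := by
    intro h
    have : (TrivSqZeroExt.fstHom ℂ E E).comp φ = aeval x := by
      ext i
      simp [φ]
    exact AlgHom.congr_fun this h
  have hsnd : ∀ h, (φ h).snd = grad h x ⬝ᵥ t := by
    intro h
    have := eq_sum_grad_of_leibniz x (fun h => (φ h).snd) (by simp)
      (fun c => by
        simp only [φ, aeval_C]
        exact TrivSqZeroExt.snd_inl E _)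
      (fun f g => by simp [hfst, TrivSqZeroExt.snd_mul, mul_comm]) h
    simpa [φ] using this
  have hker : ∀ h ∈ I, φ h = 0 := by
    intro h hh
    refine TrivSqZeroExt.ext ?_ ?_
    · rw [hfst]
      exact hh
    · rw [hsnd]
      exact ht _ (Submodule.subset_span ⟨h, hh, rfl⟩)
  let f : A →+* TrivSqZeroExt E E := Ideal.Quotient.lift I φ.toRingHom hker
  let g : TrivSqZeroExt E E →+* E := (TrivSqZeroExt.fstHom ℂ E E).toRingHom
  have hgker : RingHom.ker g ^ 2 = ⊥ := by
    rw [pow_two, eq_bot_iff, Ideal.mul_le]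
    intro a ha b hb
    have ha' : a.fst = 0 := ha
    have hb' : b.fst = 0 := hb
    refine TrivSqZeroExt.ext ?_ ?_ <;> simp [ha', hb']
  obtain ⟨F, hF1, hF2⟩ := exists_lift_of_formallySmooth f g
    (fun e => ⟨TrivSqZeroExt.inl e, rfl⟩) ⟨2, hgker⟩ (by
      apply Ideal.Quotient.ringHom_ext
      exact RingHom.ext hfst)
  have hF1' : ∀ h, F (aeval x h) = φ h := fun h => RingHom.congr_fun hF1 (Ideal.Quotient.mk I h)
  have hF2' : ∀ e, (F e).fst = e := fun e => RingHom.congr_fun hF2 e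
  have hFc : ∀ c : ℂ, F (algebraMap ℂ E c) = TrivSqZeroExt.inl (algebraMap ℂ E c) := by
    intro c
    have := hF1' (C c)
    rw [aeval_C] at this
    rw [this]
    simp only [φ, aeval_C]
    rfl
  -- A section of the projection from the dual numbers has the form `e ↦ e + ε D e` with `D` a
  -- derivation.
  refine ⟨Derivation.mk' { toFun := fun e => (F e).snd, map_add' := by simp, map_smul' := ?_ } ?_,
    fun i => ?_⟩
  · intro c e
    simp [Algebra.smul_def, hFc, hF2']
  · intro a b
    simp [hF2', mul_comm]
  · have := hF1' (X i)
    rw [aeval_X] at this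
    simp [this, φ]

end Derivations

/-! ### Orthogonal complements for the dot product -/

section Perp

variable {σ : Type} [Fintype σ] {k : Type} [Field k]

/-- The orthogonal complement with respect to the dot product. -/
def perp (W : Submodule k (σ → k)) : Submodule k (σ → k) where
  carrier := {t | ∀ v ∈ W, v ⬝ᵥ t = 0}
  zero_mem' := by simp
  add_mem' := fun ha hb v hv => by rw [dotProduct_add, ha v hv, hb v hv, add_zero]
  smul_mem' := fun c a ha v hv => by rw [dotProduct_smul, ha v hv, smul_zero]

theorem mem_perp {W : Submodule k (σ → k)} {t : σ → k} : t ∈ perp W ↔ ∀ v ∈ W, v ⬝ᵥ t = 0 :=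
  Iff.rfl

theorem mem_perp_span {s : Set (σ → k)} {t : σ → k} :
    t ∈ perp (Submodule.span k s) ↔ ∀ v ∈ s, v ⬝ᵥ t = 0 := by
  refine ⟨fun h v hv => h v (Submodule.subset_span hv), fun h v hv => ?_⟩
  induction hv using Submodule.span_induction with
  | mem v hv => exact h v hv
  | zero => simp
  | add v w _ _ hv hw => rw [add_dotProduct, hv, hw, add_zero]
  | smul a v _ hv => rw [smul_dotProduct, hv, smul_zero]

theorem finrank_add_finrank_perp (W : Submodule k (σ → k)) :
    Module.finrank k W + Module.finrank k (perp W) = Fintype.card σ := by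
  classical
  have h := Subspace.finrank_add_finrank_dualCoannihilator_eq
    (W.map (dotProductEquiv k σ).toLinearMap)
  rw [LinearEquiv.finrank_map_eq, Module.finrank_fintype_fun_eq_card] at h
  rw [← h]
  have : perp W = (W.map (dotProductEquiv k σ).toLinearMap).dualCoannihilator := by
    ext t
    simp only [mem_perp, Submodule.mem_dualCoannihilator, Submodule.mem_map]
    constructor
    · rintro h _ ⟨v, hv, rfl⟩
      exact h v hv
    · intro h v hv
      exact h _ ⟨v, hv, rfl⟩
  rw [this]

theorem perp_perp (W : Submodule k (σ → k)) : perp (perp W) = W := by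
  symm
  apply Submodule.eq_of_le_of_finrank_eq
  · intro v hv t ht
    rw [dotProduct_comm]
    exact ht v hv
  · have h1 := finrank_add_finrank_perp W
    have h2 := finrank_add_finrank_perp (perp W)
    omega

end Perp

/-! ### Conormal rank at a generic point equals codimension -/

section Dimension

variable {σ : Type} [Fintype σ] {E : Type} [Field E] [Algebra ℂ E]

/-- A derivation that vanishes on a transcendence basis of a subring vanishes on the subring. -/
theorem derivation_eq_zero_of_isTranscendenceBasis {A : Type} [CommRing A] [Algebra ℂ A]
    [Algebra A E] [IsScalarTower ℂ A E] {κ : Type} {b : κ → A} (hb : IsTranscendenceBasis ℂ b)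
    [FaithfulSMul A E] (D : Derivation ℂ E E) (hD : ∀ j, D (algebraMap A E (b j)) = 0) (a : A) :
    D (algebraMap A E a) = 0 := by
  -- The constants of `D` form a field, and `a` is algebraic over it.
  let F : IntermediateField ℂ E :=
    { carrier := {e | D e = 0}
      mul_mem' := fun {a b} ha hb => by
        have ha' : D a = 0 := ha
        have hb' : D b = 0 := hb
        simp [ha', hb']
      add_mem' := fun {a b} ha hb => by
        have ha' : D a = 0 := ha
        have hb' : D b = 0 := hb
        simp [ha', hb']
      algebraMap_mem' := fun c => D.map_algebraMap c
      inv_mem' := fun e he => by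
        have he' : D e = 0 := he
        simp [Derivation.leibniz_inv, he'] }
  let D' : Derivation F E E := Derivation.mk'
    { toFun := D
      map_add' := by simp
      map_smul' := fun c e => by
        have hc : D (c : E) = 0 := c.2
        simp [Algebra.smul_def, hc] } (by simp)
  have halg : IsAlgebraic F (algebraMap A E a) := by
    have := hb.isAlgebraic.isAlgebraic a
    obtain ⟨p, hp, hpa⟩ := this
    have hmem : ∀ c : Algebra.adjoin ℂ (Set.range b), algebraMap A E c ∈ F := by
      intro c
      have : Algebra.adjoin ℂ (Set.range b) ≤
          F.toSubalgebra.comap (IsScalarTower.toAlgHom ℂ A E) := by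
        rw [Algebra.adjoin_le_iff]
        rintro _ ⟨j, rfl⟩
        exact hD j
      exact this c.2
    let ψ : Algebra.adjoin ℂ (Set.range b) →+* F :=
      ((algebraMap A E).comp (algebraMap _ A)).codRestrict F.toSubfield hmem
    have hψ : Function.Injective ψ := by
      intro c d hcd
      have := congrArg Subtype.val hcd
      exact Subtype.ext (FaithfulSMul.algebraMap_injective A E this)
    refine ⟨p.map ψ, (Polynomial.map_ne_zero_iff hψ).2 hp, ?_⟩
    have : (algebraMap F E).comp ψ = (algebraMap A E).comp (algebraMap _ A) := rfl
    rw [Polynomial.aeval_def, Polynomial.eval₂_map, this, ← Polynomial.hom_eval₂,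
      ← Polynomial.aeval_def, hpa, map_zero]
  -- For the minimal polynomial `m` of `a`, `0 = D (m a) = m' a * D a`, and `m' a ≠ 0` by
  -- separability.
  have h0 := D'.map_aeval (minpoly F (algebraMap A E a)) (algebraMap A E a)
  rw [minpoly.aeval, map_zero] at h0
  have : CharZero F := charZero_of_injective_algebraMap (algebraMap ℂ F).injective
  have hsep := (minpoly.irreducible halg.isIntegral).separable
  have := hsep.aeval_derivative_ne_zero (minpoly.aeval F (algebraMap A E a))
  rw [eq_comm, smul_eq_mul, mul_eq_zero] at h0
  exact h0.resolve_left this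

/-- The ideal of polynomials vanishing at a point with coordinates in an extension field. -/
abbrev pointIdeal (x : σ → E) : Ideal (MvPolynomial σ ℂ) :=
  RingHom.ker (aeval x : MvPolynomial σ ℂ →ₐ[ℂ] E)

/-- The dimension of the conormal space at the generic point of a variety is the codimension. -/
theorem exists_finrank_conormalSpace_add [Algebra.EssFiniteType ℂ E] (x : σ → E) :
    ∃ d : ℕ, Algebra.trdeg ℂ (MvPolynomial σ ℂ ⧸ pointIdeal x) = d ∧
      ringKrullDim (MvPolynomial σ ℂ ⧸ pointIdeal x) = (d : WithBot ℕ∞) ∧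
      Module.finrank E (conormalSpace x) + d = Fintype.card σ := by
  have hI : (pointIdeal x).IsPrime := RingHom.ker_isPrime _
  obtain ⟨d, hd1, hd2⟩ := exists_ringKrullDim_eq_trdeg ℂ (MvPolynomial σ ℂ ⧸ pointIdeal x)
  refine ⟨d, hd2, hd1, ?_⟩
  let A := MvPolynomial σ ℂ ⧸ pointIdeal x
  let ιA : A →ₐ[ℂ] E := Ideal.Quotient.liftₐ (pointIdeal x) (aeval x) (fun a ha => ha)
  let : Algebra A E := ιA.toRingHom.toAlgebra
  have hinj : Function.Injective (algebraMap A E) := by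
    rw [injective_iff_map_eq_zero]
    intro a
    obtain ⟨a, rfl⟩ := Ideal.Quotient.mk_surjective a
    intro ha
    exact Ideal.Quotient.eq_zero_iff_mem.2 ha
  have : FaithfulSMul A E := (faithfulSMul_iff_algebraMap_injective _ _).2 hinj
  have : IsScalarTower ℂ A E := IsScalarTower.of_algebraMap_eq fun r => (ιA.commutes r).symm
  let xA : σ → A := fun i => Ideal.Quotient.mk _ (X i)
  have hxA : ∀ i, algebraMap A E (xA i) = x i := fun i => aeval_X x i
  have htop : Algebra.adjoin ℂ (Set.range xA) = ⊤ := by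
    have := Algebra.adjoin_range_eq_range_aeval ℂ xA
    rw [this, AlgHom.range_eq_top]
    have h2 : (aeval xA : MvPolynomial σ ℂ →ₐ[ℂ] A) = Ideal.Quotient.mkₐ ℂ (pointIdeal x) := by
      ext i
      rw [aeval_X]
      rfl
    rw [h2]
    exact Ideal.Quotient.mk_surjective
  have : Algebra.IsAlgebraic (Algebra.adjoin ℂ (Set.range xA)) A := by
    refine ⟨fun a => ?_⟩
    exact isAlgebraic_algebraMap (⟨a, htop ▸ Algebra.mem_top⟩ : Algebra.adjoin ℂ (Set.range xA))
  -- With a transcendence basis chosen among the coordinates, projecting tangent vectors to these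
  -- coordinates is an isomorphism.
  obtain ⟨s, hs, hb⟩ := exists_isTranscendenceBasis_subset (R := ℂ) (Set.range xA)
  have hfin : s.Finite := (Set.finite_range xA).subset hs
  have := hfin.fintype
  choose ind hind using fun j : s => hs j.2
  have hcard : Fintype.card s = d := by
    have := hb.cardinalMk_eq_trdeg
    rw [hd2, Cardinal.mk_fintype] at this
    exact_mod_cast this
  rw [← finrank_add_finrank_perp (conormalSpace x), ← hcard, ← Module.finrank_fintype_fun_eq_card E]
  congr 1
  symm
  let π : perp (conormalSpace x) →ₗ[E] (s → E) :=
    { toFun := fun t j => t.1 (ind j)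
      map_add' := fun _ _ => rfl
      map_smul' := fun _ _ => rfl }
  refine LinearEquiv.finrank_eq (LinearEquiv.ofBijective π ⟨?_, ?_⟩)
  · rw [injective_iff_map_eq_zero]
    intro t ht
    obtain ⟨D, hD⟩ := exists_derivation x t.1 t.2
    have hz : ∀ a, D (algebraMap A E a) = 0 := by
      refine derivation_eq_zero_of_isTranscendenceBasis hb D fun j => ?_
      rw [← hind j, hxA, hD]
      exact congrFun ht j
    ext i
    rw [← hD, ← hxA, hz]
    rfl
  · intro v
    have hai : AlgebraicIndependent ℂ fun j : s => algebraMap A E j :=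
      hb.1.map' (f := IsScalarTower.toAlgHom ℂ A E) hinj
    -- Algebraically independent elements satisfy no equation, so their conormal space is zero and
    -- any prescribed values `v` extend to a derivation.
    obtain ⟨D, hD⟩ := exists_derivation (fun j : s => algebraMap A E j) v (by
      intro w hw
      suffices h : w ∈ (⊥ : Submodule E (s → E)) by
        rw [(Submodule.mem_bot E).1 h, zero_dotProduct]
      refine Submodule.span_le.2 ?_ hw
      rintro _ ⟨h, h0, rfl⟩
      have : h = 0 := by
        apply hai
        simpa using h0
      rw [this]
      simp only [SetLike.mem_coe, Submodule.mem_bot]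
      ext i
      simp [grad])
    refine ⟨⟨fun i => D (x i), fun w hw => dotProduct_derivation_eq_zero D x hw⟩, ?_⟩
    ext j
    change D (x (ind j)) = v j
    rw [← hxA, hind, hD]

end Dimension

/-! ### Minors and specialization -/

section Minors

variable {σ : Type}

theorem exists_det_ne_zero [Fintype σ] {k : Type} [Field k] {r : ℕ} {v : Fin r → σ → k}
    (hv : LinearIndependent k v) :
    ∃ c : Fin r → σ, (Matrix.of fun i j => v i (c j)).det ≠ 0 := by
  let M : Matrix (Fin r) σ k := Matrix.of v
  have hrank : Module.finrank k (Submodule.span k (Set.range M.col)) = r := by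
    rw [← Matrix.rank_eq_finrank_span_cols, LinearIndependent.rank_matrix (M := M) hv,
      Fintype.card_fin]
  obtain ⟨f, hf, -, hli⟩ := Submodule.exists_fun_fin_finrank_span_eq k (Set.range M.col)
  choose c hc using fun i => hf (Fin.cast hrank.symm i)
  refine ⟨c, ?_⟩
  have hli' := hli.comp (Fin.cast hrank.symm) (Fin.cast_injective _)
  have : (Matrix.of fun i j => v i (c j)).col = f ∘ Fin.cast hrank.symm := by
    funext j
    exact hc j
  rw [← this, Matrix.linearIndependent_cols_iff_isUnit, Matrix.isUnit_iff_isUnit_det] at hli'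
  exact hli'.ne_zero

theorem linearIndependent_of_det_ne_zero {k : Type} [Field k] {r : ℕ} {v : Fin r → σ → k}
    (c : Fin r → σ) (h : (Matrix.of fun i j => v i (c j)).det ≠ 0) : LinearIndependent k v := by
  have hu : IsUnit (Matrix.of fun i j => v i (c j)) := by
    rw [Matrix.isUnit_iff_isUnit_det]
    exact h.isUnit
  rw [← Matrix.linearIndependent_rows_iff_isUnit] at hu
  exact LinearIndependent.of_comp (LinearMap.funLeft k k c) hu

/-- A point with complex coordinates is a specialization of a point with coordinates in an
extension field if all polynomial equations of the latter hold for it. -/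
def Specializes {τ E : Type} [Field E] [Algebra ℂ E] (z : τ → E) (q : τ → ℂ) : Prop :=
  ∀ h : MvPolynomial τ ℂ, aeval z h = 0 → aeval q h = 0

variable {τ E : Type} [Field E] [Algebra ℂ E]

theorem aeval_det {A : Type} [CommRing A] [Algebra ℂ A] {r : ℕ} (z : τ → A)
    (M : Matrix (Fin r) (Fin r) (MvPolynomial τ ℂ)) :
    aeval z M.det = (Matrix.of fun i j => aeval z (M i j)).det := by
  rw [AlgHom.map_det]
  rfl

/-- Linear independence passes from a specialization to the generic point. -/
theorem Specializes.linearIndependent [Fintype σ] {z : τ → E} {q : τ → ℂ}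
    (hq : Specializes z q) {r : ℕ}
    {V : Fin r → σ → MvPolynomial τ ℂ}
    (h : LinearIndependent ℂ fun i j => aeval q (V i j)) :
    LinearIndependent E fun i j => aeval z (V i j) := by
  obtain ⟨c, hc⟩ := exists_det_ne_zero h
  refine linearIndependent_of_det_ne_zero c ?_
  have h1 := aeval_det z (Matrix.of fun i j => V i (c j))
  have h2 := aeval_det q (Matrix.of fun i j => V i (c j))
  simp only [Matrix.of_apply] at h1 h2
  rw [← h1]
  rw [← h2] at hc
  exact fun h0 => hc (hq _ h0)

/-- Selecting indices rather than vectors keeps hold of the polynomials whose gradients are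
independent. -/
theorem exists_fin_linearIndependent [Fintype σ] {k : Type} [Field k] {ι : Type*} (v : ι → σ → k)
    (s : Set ι) :
    ∃ g : Fin (Module.finrank k (Submodule.span k (v '' s))) → ι,
      (∀ i, g i ∈ s) ∧ LinearIndependent k (fun i => v (g i)) ∧
      Submodule.span k (Set.range fun i => v (g i)) = Submodule.span k (v '' s) := by
  obtain ⟨f, hf, hs, hli⟩ := Submodule.exists_fun_fin_finrank_span_eq k (v '' s)
  choose g hg hgf using hf
  have : (fun i => v (g i)) = f := funext hgf
  exact ⟨g, hg, by rwa [this], by rwa [this]⟩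

end Minors

/-! ### Reflexivity and the ideal of the conormal variety -/

section ConormalPairs

variable {σ : Type} [Fintype σ] {E : Type} [Field E] [Algebra ℂ E]

/-- Euler's formula for each homogeneous component; `hx` says that the ideal of `x` is homogeneous.
-/
theorem dotProduct_eq_zero_of_mem_conormalSpace {x v : σ → E}
    (hx : ∀ h : MvPolynomial σ ℂ, aeval x h = 0 → ∀ d, aeval x (homogeneousComponent d h) = 0)
    (hv : v ∈ conormalSpace x) : v ⬝ᵥ x = 0 := by
  revert v
  change x ∈ perp (conormalSpace x)
  rw [conormalSpace, mem_perp_span]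
  rintro _ ⟨h, h0, rfl⟩
  have hd : ∀ d, grad (homogeneousComponent d h) x ⬝ᵥ x = 0 := by
    intro d
    have := congrArg (aeval x) (homogeneousComponent_isHomogeneous d h).sum_X_mul_pderiv
    rw [map_nsmul, hx h h0, smul_zero, map_sum] at this
    simpa [grad, dotProduct, mul_comm] using this
  have hsum : grad h x ⬝ᵥ x = ∑ d ∈ Finset.range (h.totalDegree + 1),
      grad (homogeneousComponent d h) x ⬝ᵥ x := by
    conv_lhs => rw [← sum_homogeneousComponent h]
    simp only [grad, map_sum, dotProduct, Finset.sum_mul]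
    exact Finset.sum_comm
  rw [hsum, Finset.sum_eq_zero fun d _ => hd d]

/-- Reflexivity at the generic point of the conormal variety. -/
theorem mem_conormalSpace_symm [Algebra.EssFiniteType ℂ E] {x y : σ → E}
    (hy : y ∈ conormalSpace x) (hxy : y ⬝ᵥ x = 0) : x ∈ conormalSpace y := by
  rw [← perp_perp (conormalSpace y)]
  intro t ht
  -- Differentiating `y ⬝ᵥ x = 0` along `D y = t` gives `t ⬝ᵥ x = 0`, since `y ⬝ᵥ D x = 0` by
  -- conormality of `y` at `x`.
  obtain ⟨D, hD⟩ := exists_derivation y t ht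
  have h1 := dotProduct_derivation_eq_zero D x hy
  have h2 := congrArg D hxy
  simp only [dotProduct, map_sum, Derivation.leibniz, smul_eq_mul, map_zero, hD,
    Finset.sum_add_distrib] at h1 h2 ⊢
  rw [h1, zero_add] at h2
  rw [← h2]
  exact Finset.sum_congr rfl fun i _ => mul_comm _ _

/-- The generic point of a conormal variety and its dual: a pair of points with coordinates in a
field that is generated by these coordinates and has the transcendence degree of the affine
bicone over the conormal variety. -/
structure ConormalPair (x y : σ → E) : Prop where
  essFiniteType : Algebra.EssFiniteType ℂ E
  trdeg_eq : Algebra.trdeg ℂ E = Fintype.card σ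
  adjoin_eq_top : IntermediateField.adjoin ℂ (Set.range x ∪ Set.range y) = ⊤
  mem_left : y ∈ conormalSpace x
  mem_right : x ∈ conormalSpace y

theorem ConormalPair.symm {x y : σ → E} (h : ConormalPair x y) : ConormalPair y x :=
  ⟨h.1, h.2, by rw [Set.union_comm]; exact h.3, h.5, h.4⟩

/-- The combination of the gradients of `F` at `p` with coefficients `c`. -/
def gradComb {A : Type} [CommRing A] [Algebra ℂ A] {r : ℕ} (F : Fin r → MvPolynomial σ ℂ)
    (p : σ → A) (c : Fin r → A) : σ → A :=
  fun i => ∑ j, c j * grad (F j) p i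

/-- The pullback of a polynomial in two groups of variables under the parametrization
`(p, c) ↦ (p, ∑ j, c j • ∇(F j) p)` of the conormal variety. -/
def conormalPullback {r : ℕ} (F : Fin r → MvPolynomial σ ℂ) :
    MvPolynomial (σ ⊕ σ) ℂ →ₐ[ℂ] MvPolynomial (Fin r) (MvPolynomial σ ℂ) :=
  aeval (Sum.elim (fun i => C (X i)) (fun i => ∑ j, X j * C (pderiv i (F j))))

omit [Fintype σ] in
theorem eval₂_conormalPullback {A : Type} [CommRing A] [Algebra ℂ A] {r : ℕ}
    (F : Fin r → MvPolynomial σ ℂ) (p : σ → A) (c : Fin r → A) (H : MvPolynomial (σ ⊕ σ) ℂ) :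
    eval₂ (aeval p : MvPolynomial σ ℂ →ₐ[ℂ] A).toRingHom c (conormalPullback F H) =
      aeval (Sum.elim p (gradComb F p c)) H := by
  have h : ((eval₂Hom (aeval p : MvPolynomial σ ℂ →ₐ[ℂ] A).toRingHom c).comp
      (conormalPullback F).toRingHom) = (aeval (Sum.elim p (gradComb F p c)) :
        MvPolynomial (σ ⊕ σ) ℂ →ₐ[ℂ] A).toRingHom := by
    apply MvPolynomial.ringHom_ext
    · intro a
      simp [conormalPullback, IsScalarTower.algebraMap_apply ℂ (MvPolynomial σ ℂ)
        (MvPolynomial (Fin r) (MvPolynomial σ ℂ)), algebraMap_eq]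
    · rintro (i | i)
      · simp [conormalPullback]
      · simp [conormalPullback, gradComb, grad]
  exact RingHom.congr_fun h H

theorem conormalSpace_eq_span {x : σ → E} {r : ℕ} {F : Fin r → MvPolynomial σ ℂ}
    (hF : ∀ j, aeval x (F j) = 0) (hli : LinearIndependent E fun j => grad (F j) x)
    (hr : Module.finrank E (conormalSpace x) = r) :
    conormalSpace x = Submodule.span E (Set.range fun j => grad (F j) x) := by
  symm
  apply Submodule.eq_of_le_of_finrank_eq
  · rw [Submodule.span_le]
    rintro _ ⟨j, rfl⟩
    exact Submodule.subset_span ⟨F j, hF j, rfl⟩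
  · rw [finrank_span_eq_card hli, hr, Fintype.card_fin]

/-- The Nullstellensatz for the prime ideal of `x`. -/
theorem aeval_eq_zero_iff_forall_specializes (x : σ → E) (h : MvPolynomial σ ℂ) :
    aeval x h = 0 ↔ ∀ p, Specializes x p → aeval p h = 0 := by
  refine ⟨fun h0 p hp => hp h h0, fun H => ?_⟩
  have hI : (pointIdeal x).IsPrime := RingHom.ker_isPrime _
  have := IsPrime.vanishingIdeal_zeroLocus (K := ℂ) (pointIdeal x)
  change h ∈ pointIdeal x
  rw [← this]
  exact fun p hp => H p fun g hg => hp g hg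

open Algebra in
/-- The ideal of the conormal variety, computed by a parametrization. -/
theorem ConormalPair.aeval_eq_zero_iff {x y : σ → E} (hxy : ConormalPair x y) {r : ℕ}
    {F : Fin r → MvPolynomial σ ℂ} (hF : ∀ j, aeval x (F j) = 0)
    (hli : LinearIndependent E fun j => grad (F j) x)
    (hr : Module.finrank E (conormalSpace x) = r) (H : MvPolynomial (σ ⊕ σ) ℂ) :
    aeval (Sum.elim x y) H = 0 ↔
      ∀ p, Specializes x p → ∀ c, aeval (Sum.elim p (gradComb F p c)) H = 0 := by
  have := hxy.essFiniteType
  have hy := hxy.mem_left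
  rw [conormalSpace_eq_span hF hli hr, Submodule.mem_span_range_iff_exists_fun] at hy
  obtain ⟨μ, hμ⟩ := hy
  have hyμ : y = gradComb F x μ := by
    rw [← hμ]
    ext i
    simp [gradComb]
  have hI : (pointIdeal x).IsPrime := RingHom.ker_isPrime _
  let A := MvPolynomial σ ℂ ⧸ pointIdeal x
  let ιA : A →ₐ[ℂ] E := Ideal.Quotient.liftₐ (pointIdeal x) (aeval x) (fun a ha => ha)
  let : Algebra A E := ιA.toRingHom.toAlgebra
  have hmk : ∀ h, algebraMap A E (Ideal.Quotient.mk _ h) = aeval x h := fun h => rfl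
  have hinj : Function.Injective (algebraMap A E) := by
    rw [injective_iff_map_eq_zero]
    intro a
    obtain ⟨a, rfl⟩ := Ideal.Quotient.mk_surjective a
    intro ha
    exact Ideal.Quotient.eq_zero_iff_mem.2 ha
  have : FaithfulSMul A E := (faithfulSMul_iff_algebraMap_injective _ _).2 hinj
  have : IsScalarTower ℂ A E := IsScalarTower.of_algebraMap_eq fun r => (ιA.commutes r).symm
  obtain ⟨d, hd1, -, hd2⟩ := exists_finrank_conormalSpace_add x
  -- The total degree is `r + d`, and the coordinate ring `A` of `x` accounts for `d`.
  have htr : Algebra.trdeg A E = r := by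
    have h1 := trdeg_add_eq ℂ A (A := E)
    rw [hxy.trdeg_eq, ← hd2, hr, hd1] at h1
    have hfin : Algebra.trdeg A E < Cardinal.aleph0 := by
      refine lt_of_le_of_lt le_add_self (h1.trans_lt ?_)
      exact Cardinal.natCast_lt_aleph0
    obtain ⟨e, he⟩ := Cardinal.lt_aleph0.1 hfin
    rw [he] at h1 ⊢
    have : d + e = r + d := by exact_mod_cast h1
    congr 1
    omega
  let S := Algebra.adjoin A (Set.range μ)
  have hμS : ∀ j, IsAlgebraic S (μ j) := fun j =>
    isAlgebraic_algebraMap (⟨μ j, Algebra.subset_adjoin ⟨j, rfl⟩⟩ : S)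
  have hAS : ∀ a : A, IsAlgebraic S (algebraMap A E a) := fun a =>
    isAlgebraic_algebraMap (algebraMap A S a)
  have halg : Algebra.IsAlgebraic S E := by
    refine ⟨fun e => ?_⟩
    have he : e ∈ IntermediateField.adjoin ℂ (Set.range x ∪ Set.range y) := by
      rw [hxy.adjoin_eq_top]
      trivial
    induction he using IntermediateField.adjoin_induction with
    | mem e he =>
      rcases he with ⟨i, rfl⟩ | ⟨i, rfl⟩
      · have := hAS (Ideal.Quotient.mk _ (X i))
        rwa [hmk, aeval_X] at this
      · rw [hyμ]
        refine Finset.sum_induction _ (IsAlgebraic S) (fun _ _ => IsAlgebraic.add)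
          isAlgebraic_zero fun j _ => (hμS j).mul ?_
        have := hAS (Ideal.Quotient.mk _ (pderiv i (F j)))
        rwa [hmk] at this
    | algebraMap c =>
      have := hAS (algebraMap ℂ A c)
      rwa [← IsScalarTower.algebraMap_apply] at this
    | add a b _ _ ha hb => exact ha.add hb
    | inv a _ ha => exact ha.inv
    | mul a b _ _ ha hb => exact ha.mul hb
  -- `E` is algebraic over `A[μ]`, so the `r` elements `μ` must be independent. A polynomial in them
  -- therefore vanishes only if all its coefficients do.
  have hind : AlgebraicIndependent A μ :=
    (Algebra.IsAlgebraic.isTranscendenceBasis_of_le_trdeg_of_finite A μ (by simp [htr])).1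
  have hcomp : (algebraMap A E).comp (Ideal.Quotient.mk (pointIdeal x)) =
      (aeval x : MvPolynomial σ ℂ →ₐ[ℂ] E).toRingHom := rfl
  have hE : aeval (Sum.elim x y) H =
      aeval μ (map (Ideal.Quotient.mk (pointIdeal x)) (conormalPullback F H)) := by
    rw [aeval_def μ, eval₂_map, hcomp, eval₂_conormalPullback, ← hyμ]
  have hE0 : aeval (Sum.elim x y) H = 0 ↔ ∀ m, aeval x (coeff m (conormalPullback F H)) = 0 := by
    rw [hE, ← map_zero (aeval μ : MvPolynomial (Fin r) A →ₐ[A] E), hind.eq_iff,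
      MvPolynomial.ext_iff]
    refine forall_congr' fun m => ?_
    rw [coeff_map, coeff_zero, Ideal.Quotient.eq_zero_iff_mem]
    rfl
  rw [hE0]
  constructor
  · intro h p hp c
    rw [← eval₂_conormalPullback, eval₂_eq_eval_map]
    have : map (aeval p : MvPolynomial σ ℂ →ₐ[ℂ] ℂ).toRingHom (conormalPullback F H) = 0 := by
      ext m
      rw [coeff_map, coeff_zero]
      exact hp _ (h m)
    rw [this, map_zero]
  · intro h m
    rw [aeval_eq_zero_iff_forall_specializes]
    intro p hp
    have : map (aeval p : MvPolynomial σ ℂ →ₐ[ℂ] ℂ).toRingHom (conormalPullback F H) = 0 := by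
      apply MvPolynomial.funext
      intro c
      rw [← eval₂_eq_eval_map, eval₂_conormalPullback, h p hp c, map_zero]
    have := congrArg (coeff m) this
    rwa [coeff_map, coeff_zero] at this

end ConormalPairs

/-! ### Construction of the generic conormal pair -/

section Construction

variable {σ : Type} [Fintype σ]

omit [Fintype σ] in
/-- Coefficients of an independent family of vectors over a subfield lie in the subfield if the
combination does. -/
theorem coeff_mem_of_sum_mem {E : Type} [Field E] [Algebra ℂ E] (L : IntermediateField ℂ E)
    [Fintype σ]
    {r : ℕ} {v : Fin r → σ → E} (hv : ∀ j i, v j i ∈ L) (hli : LinearIndependent E v)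
    {c : Fin r → E} (hc : ∀ i, ∑ j, c j * v j i ∈ L) (j : Fin r) : c j ∈ L := by
  obtain ⟨s, hs⟩ := exists_det_ne_zero hli
  let M : Matrix (Fin r) (Fin r) E := Matrix.of fun i j => v i (s j)
  let ML : Matrix (Fin r) (Fin r) L := Matrix.of fun i j => ⟨v i (s j), hv i (s j)⟩
  let y : Fin r → L := fun l => ⟨∑ j, c j * v j (s l), hc (s l)⟩
  have hM : M = ML.map (algebraMap L E) := rfl
  have hdet : ML.det ≠ 0 := by
    intro h0
    apply hs
    change M.det = 0
    rw [hM, ← RingHom.mapMatrix_apply, ← RingHom.map_det, h0, map_zero]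
  -- The invertible minor is solved over `L`; uniqueness over `E` identifies the solution with `c`.
  let ν := Matrix.vecMul y ML⁻¹
  have hν : Matrix.vecMul ν ML = y := by
    rw [Matrix.vecMul_vecMul, Matrix.nonsing_inv_mul _ hdet.isUnit, Matrix.vecMul_one]
  have hνM : Matrix.vecMul (fun j => (ν j : E)) M = Matrix.vecMul c M := by
    funext l
    have := congrArg (Subtype.val) (congrFun hν l)
    simpa [Matrix.vecMul, dotProduct, M, ML, y] using this
  have hinj := Matrix.vecMul_injective_of_isUnit ((Matrix.isUnit_iff_isUnit_det M).2
    (Ne.isUnit hs))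
  rw [← hinj hνM]
  exact (ν j).2

open Algebra in
/-- Every irreducible cone with a point at which the rank of the Jacobian matrix is the
codimension is the first component of a generic conormal pair. -/
theorem exists_conormalPair {P : Ideal (MvPolynomial σ ℂ)} [hP : P.IsPrime]
    (hhom : ∀ h ∈ P, ∀ d, homogeneousComponent d h ∈ P) {r d : ℕ}
    {F : Fin r → MvPolynomial σ ℂ} (hF : ∀ j, F j ∈ P)
    (hd : ringKrullDim (MvPolynomial σ ℂ ⧸ P) = (d : WithBot ℕ∞)) (hr : r + d = Fintype.card σ)
    {p : σ → ℂ} (hp : ∀ h ∈ P, aeval p h = 0) (hli : LinearIndependent ℂ fun j => grad (F j) p) :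
    ∃ (E : Type) (_ : Field E) (_ : Algebra ℂ E) (x y : σ → E),
      pointIdeal x = P ∧ ConormalPair x y := by
  let B := MvPolynomial σ ℂ ⧸ P
  -- The coefficients of the gradients become free variables over the coordinate ring, giving
  -- transcendence degree `d + r`.
  let M := MvPolynomial (Fin r) B
  let E := FractionRing M
  have hBM : Function.Injective (algebraMap B M) := MvPolynomial.C_injective _ _
  have hME : Function.Injective (algebraMap M E) := IsFractionRing.injective M E
  let xB : σ → B := fun i => Ideal.Quotient.mk P (X i)
  let x : σ → E := fun i => algebraMap B E (xB i)
  let μ : Fin r → E := fun j => algebraMap M E (X j)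
  let y : σ → E := gradComb F x μ
  have hBE : Function.Injective (algebraMap B E) := by
    rw [IsScalarTower.algebraMap_eq B M E]
    exact hME.comp hBM
  have haeval : ∀ h, aeval x h = algebraMap B E (Ideal.Quotient.mk P h) := by
    intro h
    have : (aeval x : MvPolynomial σ ℂ →ₐ[ℂ] E) =
        (IsScalarTower.toAlgHom ℂ B E).comp (Ideal.Quotient.mkₐ ℂ P) := by
      apply MvPolynomial.algHom_ext
      intro i
      rw [aeval_X]
      rfl
    rw [this]
    rfl
  have hx' : ∀ h, aeval x h = 0 ↔ h ∈ P := fun h => by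
    rw [haeval, map_eq_zero_iff _ hBE, Ideal.Quotient.eq_zero_iff_mem]
  have hx : pointIdeal x = P := Ideal.ext hx'
  have hspec : Specializes x p := fun h h0 => hp h ((hx' h).1 h0)
  have hliE : LinearIndependent E fun j => grad (F j) x :=
    hspec.linearIndependent (V := fun j i => pderiv i (F j)) hli
  have hy : y ∈ conormalSpace x := by
    have : y = ∑ j, μ j • grad (F j) x := by
      ext i
      simp [y, gradComb]
    rw [this]
    exact Submodule.sum_mem _ fun j _ => Submodule.smul_mem _ _
      (Submodule.subset_span ⟨F j, (hx' _).2 (hF j), rfl⟩)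
  have hL : IntermediateField.adjoin ℂ (Set.range x ∪ Set.range y) = ⊤ := by
    set L := IntermediateField.adjoin ℂ (Set.range x ∪ Set.range y)
    have hxL : ∀ i, x i ∈ L := fun i =>
      IntermediateField.subset_adjoin _ _ (Or.inl ⟨i, rfl⟩)
    have hyL : ∀ i, y i ∈ L := fun i =>
      IntermediateField.subset_adjoin _ _ (Or.inr ⟨i, rfl⟩)
    have hxL' : ∀ h : MvPolynomial σ ℂ, aeval x h ∈ L := by
      intro h
      have h1 : aeval x h ∈ (aeval x : MvPolynomial σ ℂ →ₐ[ℂ] E).range := ⟨h, rfl⟩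
      rw [← Algebra.adjoin_range_eq_range_aeval] at h1
      refine Algebra.adjoin_le (S := L.toSubalgebra) ?_ h1
      rintro _ ⟨i, rfl⟩
      exact hxL i
    have hμL : ∀ j, μ j ∈ L := by
      refine coeff_mem_of_sum_mem L (v := fun j => grad (F j) x) ?_ hliE ?_
      · intro j i
        exact hxL' _
      · intro i
        exact hyL i
    have hML : ∀ m : M, algebraMap M E m ∈ L := by
      intro m
      induction m using MvPolynomial.induction_on with
      | C b =>
        obtain ⟨h, rfl⟩ := Ideal.Quotient.mk_surjective b
        have := hxL' h
        rw [haeval, IsScalarTower.algebraMap_apply B M E] at this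
        exact this
      | add a b ha hb => rw [map_add]; exact add_mem ha hb
      | mul_X a j ha => rw [map_mul]; exact mul_mem ha (hμL j)
    rw [_root_.eq_top_iff]
    intro e _
    obtain ⟨a, b, -, rfl⟩ := IsFractionRing.div_surjective (A := M) e
    exact div_mem (hML a) (hML b)
  have hess : Algebra.EssFiniteType ℂ E := by
    rw [← IntermediateField.fg_top_iff, ← hL]
    exact IntermediateField.fg_adjoin_of_finite
      ((Set.finite_range x).union (Set.finite_range y))
  have htr : Algebra.trdeg ℂ E = Fintype.card σ := by
    obtain ⟨d', hd1, hd2⟩ := exists_ringKrullDim_eq_trdeg ℂ B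
    have hdd : d' = d := by
      rw [hd] at hd1
      exact_mod_cast hd1.symm
    have : FaithfulSMul B M := (faithfulSMul_iff_algebraMap_injective _ _).2 hBM
    have : FaithfulSMul M E := (faithfulSMul_iff_algebraMap_injective _ _).2 hME
    have : Algebra.IsAlgebraic M E := IsLocalization.isAlgebraic E (nonZeroDivisors M)
    rw [← trdeg_add_eq ℂ M (A := E), ← trdeg_add_eq ℂ B (A := M), hd2,
      trdeg_eq_zero (R := M) (A := E), MvPolynomial.trdeg_of_isDomain, hdd, ← hr]
    simp [add_comm]
  have hx0 : ∀ h : MvPolynomial σ ℂ, aeval x h = 0 → ∀ e, aeval x (homogeneousComponent e h) = 0 :=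
    fun h h0 e => (hx' _).2 (hhom h ((hx' h).1 h0) e)
  exact ⟨E, inferInstance, inferInstance, x, y, hx, hess, htr, hL, hy,
    mem_conormalSpace_symm hy (dotProduct_eq_zero_of_mem_conormalSpace hx0 hy)⟩

end Construction

/-! ### Homogeneity -/

section Homogeneous

variable {σ : Type} [Fintype σ] {A : Type} [CommRing A] [Algebra ℂ A]

theorem aeval_smul_of_isHomogeneous {f : MvPolynomial σ ℂ} {d : ℕ} (hf : f.IsHomogeneous d)
    (t : ℂ) (z : σ → A) : aeval (t • z) f = t ^ d • aeval z f := by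
  rw [aeval_def, aeval_def, eval₂_eq', eval₂_eq', Finset.smul_sum]
  refine Finset.sum_congr rfl fun m hm => ?_
  have hd := hf (mem_support_iff.1 hm)
  rw [Finsupp.weight_apply, Finsupp.sum_fintype _ _ (by simp)] at hd
  simp only [Pi.smul_apply, Algebra.smul_def, mul_pow, Finset.prod_mul_distrib,
    Finset.prod_pow_eq_pow_sum, map_pow]
  simp only [Pi.one_apply, smul_eq_mul, mul_one] at hd
  rw [hd]
  ring

theorem grad_smul_of_isHomogeneous {f : MvPolynomial σ ℂ} {d : ℕ} (hf : f.IsHomogeneous d)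
    (t : ℂ) (z : σ → A) : grad f (t • z) = t ^ (d - 1) • grad f z := by
  ext i
  exact aeval_smul_of_isHomogeneous hf.pderiv t z

/-- A polynomial vanishing at all nonzero complex multiples of a point vanishes at the point
together with its homogeneous components. -/
theorem aeval_homogeneousComponent_eq_zero {E : Type} [Field E] [Algebra ℂ E] {z : σ → E}
    {f : MvPolynomial σ ℂ} (h : ∀ t : ℂ, t ≠ 0 → aeval (t • z) f = 0) (d : ℕ) :
    aeval z (homogeneousComponent d f) = 0 := by
  -- `f (t • z)` as a polynomial in `t`: infinitely many roots force every coefficient to vanish.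
  let p : Polynomial E := ∑ e ∈ Finset.range (f.totalDegree + 1),
    Polynomial.monomial e (aeval z (homogeneousComponent e f))
  have hp : p = 0 := by
    refine Polynomial.eq_zero_of_infinite_isRoot p ?_
    refine Set.Infinite.mono (s := (algebraMap ℂ E) '' {0}ᶜ) ?_ ?_
    · rintro _ ⟨t, ht, rfl⟩
      have := h t ht
      rw [← sum_homogeneousComponent f, map_sum] at this
      simp only [Set.mem_ofPred_eq, Polynomial.IsRoot, p, Polynomial.eval_finsetSum,
        Polynomial.eval_monomial]
      rw [← this]
      refine Finset.sum_congr rfl fun e _ => ?_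
      rw [aeval_smul_of_isHomogeneous (homogeneousComponent_isHomogeneous e f), Algebra.smul_def,
        map_pow, mul_comm]
    · exact (Set.infinite_of_finite_compl (by simp)).image
        (algebraMap ℂ E).injective.injOn
  have hc := congrArg (fun q => Polynomial.coeff q d) hp
  simp only [p, Polynomial.finsetSum_coeff, Polynomial.coeff_monomial, Finset.sum_ite_eq',
    Polynomial.coeff_zero, Finset.mem_range] at hc
  by_cases hd : d < f.totalDegree + 1
  · rwa [if_pos hd] at hc
  · rw [homogeneousComponent_eq_zero _ _ (by omega), map_zero]

end Homogeneous

/-! ### Jacobian rank and fibres of the conormal variety -/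

section Regularity

variable {σ : Type} [Fintype σ] {E : Type} [Field E] [Algebra ℂ E]

/-- The span of the gradients at a point of a set of polynomials. -/
def gradSpan {k : Type} [Field k] [Algebra ℂ k] (S : Set (MvPolynomial σ ℂ)) (p : σ → k) :
    Submodule k (σ → k) :=
  Submodule.span k ((fun f => grad f p) '' S)

/-- The homogeneous polynomials `S` cut out the closure of the point `x`. -/
structure CutsOut (S : Set (MvPolynomial σ ℂ)) (x : σ → E) : Prop where
  homog : ∀ f ∈ S, IsHomog f
  forall_aeval_eq_zero_iff : ∀ p : σ → ℂ, (∀ f ∈ S, aeval p f = 0) ↔ Specializes x p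

variable {S : Set (MvPolynomial σ ℂ)} {x y : σ → E}

theorem CutsOut.aeval_eq_zero (hS : CutsOut S x) {f : MvPolynomial σ ℂ} (hf : f ∈ S) :
    aeval x f = 0 := by
  rw [aeval_eq_zero_iff_forall_specializes]
  exact fun p hp => (hS.forall_aeval_eq_zero_iff p).2 hp f hf

theorem CutsOut.radical_span (hS : CutsOut S x) : (Ideal.span S).radical = pointIdeal x := by
  rw [← vanishingIdeal_zeroLocus_eq_radical (K := ℂ)]
  ext f
  change _ ↔ aeval x f = 0
  rw [aeval_eq_zero_iff_forall_specializes, mem_vanishingIdeal_iff, zeroLocus_span]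
  exact forall_congr' fun p => imp_congr_left (hS.forall_aeval_eq_zero_iff p)

/-- Krull dimension sees only the radical, so `S` need not generate the full ideal of `x`. -/
theorem CutsOut.ringKrullDim_eq (hS : CutsOut S x) :
    ringKrullDim (MvPolynomial σ ℂ ⧸ Ideal.span S) =
      ringKrullDim (MvPolynomial σ ℂ ⧸ pointIdeal x) := by
  rw [ringKrullDim_quotient, ringKrullDim_quotient, ← hS.radical_span,
    PrimeSpectrum.zeroLocus_radical]

theorem CutsOut.gradSpan_le (hS : CutsOut S x) : gradSpan S x ≤ conormalSpace x := by
  refine Submodule.span_mono ?_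
  rintro _ ⟨f, hf, rfl⟩
  exact ⟨f, hS.aeval_eq_zero hf, rfl⟩

/-- Semicontinuity of rank: a minor that is nonzero at `p` is nonzero at `x`. -/
theorem finrank_gradSpan_le_of_specializes {p : σ → ℂ} (hp : Specializes x p) :
    Module.finrank ℂ (gradSpan S p) ≤ Module.finrank E (gradSpan S x) := by
  obtain ⟨F, hF, hli, -⟩ := exists_fin_linearIndependent (fun f => grad f p) S
  have hliE : LinearIndependent E fun j => grad (F j) x :=
    hp.linearIndependent (V := fun j i => pderiv i (F j)) hli
  have hle : Submodule.span E (Set.range fun j => grad (F j) x) ≤ gradSpan S x := by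
    refine Submodule.span_mono ?_
    rintro _ ⟨j, rfl⟩
    exact ⟨F j, hF j, rfl⟩
  have := Submodule.finrank_mono hle
  rwa [finrank_span_eq_card hliE, Fintype.card_fin] at this

theorem CutsOut.finrank_gradSpan_le (hS : CutsOut S x) {p : σ → ℂ} (hp : Specializes x p) :
    Module.finrank ℂ (gradSpan S p) ≤ Module.finrank E (conormalSpace x) :=
  (finrank_gradSpan_le_of_specializes hp).trans (Submodule.finrank_mono hS.gradSpan_le)

theorem CutsOut.specializes_smul (hS : CutsOut S x) {p : σ → ℂ} (hp : Specializes x p) (t : ℂ) :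
    Specializes x (t • p) := by
  rw [← hS.forall_aeval_eq_zero_iff] at hp ⊢
  intro f hf
  obtain ⟨d, hd⟩ := hS.homog f hf
  rw [aeval_smul_of_isHomogeneous hd, hp f hf, smul_zero]

theorem gradSpan_smul (hS : ∀ f ∈ S, IsHomog f) (p : σ → ℂ) {t : ℂ} (ht : t ≠ 0) :
    gradSpan S (t • p) = gradSpan S p := by
  have key : ∀ (q : σ → ℂ) {s : ℂ}, gradSpan S (s • q) ≤ gradSpan S q := by
    intro q s
    refine Submodule.span_le.2 ?_
    rintro _ ⟨f, hf, rfl⟩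
    obtain ⟨d, hd⟩ := hS f hf
    change grad f (s • q) ∈ gradSpan S q
    rw [grad_smul_of_isHomogeneous hd]
    exact Submodule.smul_mem _ _ (Submodule.subset_span ⟨f, hf, rfl⟩)
  refine le_antisymm (key p) ?_
  have := key (t • p) (s := t⁻¹)
  rwa [smul_smul, inv_mul_cancel₀ ht, one_smul] at this

/-- Independent equations at a point at which the rank of the Jacobian matrix is the
codimension. -/
theorem Specializes.exists_fin_gradSpan {p : σ → ℂ} (hp : Specializes x p)
    (hreg : Module.finrank ℂ (gradSpan S p) = Module.finrank E (conormalSpace x)) :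
    ∃ F : Fin (Module.finrank E (conormalSpace x)) → MvPolynomial σ ℂ, (∀ j, F j ∈ S) ∧
      LinearIndependent E (fun j => grad (F j) x) ∧
      LinearIndependent ℂ (fun j => grad (F j) p) ∧
      gradSpan S p = Submodule.span ℂ (Set.range fun j => grad (F j) p) := by
  obtain ⟨F, hF, hli, hspan⟩ := exists_fin_linearIndependent (fun f => grad f p) S
  rw [← hreg]
  exact ⟨F, hF, hp.linearIndependent (V := fun j i => pderiv i (F j)) hli, hli, hspan.symm⟩

/-- The fibre of the conormal variety over a regular point consists of the vectors orthogonal to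
the tangent space. -/
theorem CutsOut.specializes_iff_mem_gradSpan (hS : CutsOut S x) (hxy : ConormalPair x y)
    {p : σ → ℂ} (hp : Specializes x p)
    (hreg : Module.finrank ℂ (gradSpan S p) = Module.finrank E (conormalSpace x)) (b : σ → ℂ) :
    Specializes (Sum.elim x y) (Sum.elim p b) ↔ b ∈ gradSpan S p := by
  obtain ⟨F, hFS, hliE, hli, hspan⟩ := hp.exists_fin_gradSpan hreg
  have hF : ∀ j, aeval x (F j) = 0 := fun j => hS.aeval_eq_zero (hFS j)
  rw [hspan]
  constructor
  · intro hb
    -- If `b` were independent of the gradients at `p`, then `y` would be independent of those at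
    -- `x`, which span the conormal space containing `y`.
    by_contra hnb
    have hcons : LinearIndependent ℂ (Fin.cons b fun j => grad (F j) p : Fin (_ + 1) → σ → ℂ) :=
      linearIndependent_finCons.2 ⟨hli, hnb⟩
    let V : Fin (Module.finrank E (conormalSpace x) + 1) → σ → MvPolynomial (σ ⊕ σ) ℂ :=
      Fin.cons (fun i => X (Sum.inr i)) (fun j i => rename Sum.inl (pderiv i (F j)))
    have hV : ∀ {A : Type} [CommRing A] [Algebra ℂ A] (z w : σ → A),
        (fun j i => aeval (Sum.elim z w) (V j i)) =
          (Fin.cons w fun j => grad (F j) z : Fin (_ + 1) → σ → A) := by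
      intro A _ _ z w
      funext j i
      refine Fin.cases ?_ (fun j => ?_) j
      · simp [V]
      · simp [V, aeval_rename, Function.comp_def, grad]
    rw [← hV] at hcons
    have h := hb.linearIndependent hcons
    rw [hV, linearIndependent_finCons] at h
    apply h.2
    rw [← conormalSpace_eq_span hF hliE rfl]
    exact hxy.mem_left
  · intro hb H hH
    rw [Submodule.mem_span_range_iff_exists_fun] at hb
    obtain ⟨c, rfl⟩ := hb
    have h := (hxy.aeval_eq_zero_iff hF hliE rfl H).1 hH p hp c
    have hc : ∑ j, c j • grad (F j) p = gradComb F p c := by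
      ext i
      simp [gradComb]
    rwa [hc]

omit [Fintype σ] in
theorem specializes_sumElim_swap {p b : σ → ℂ} :
    Specializes (Sum.elim x y) (Sum.elim p b) ↔ Specializes (Sum.elim y x) (Sum.elim b p) := by
  have key : ∀ {z w : σ → E} {q c : σ → ℂ}, Specializes (Sum.elim z w) (Sum.elim q c) →
      Specializes (Sum.elim w z) (Sum.elim c q) := by
    intro z w q c h H hH
    have h1 := h (rename Sum.swap H)
    rw [aeval_rename, aeval_rename, Sum.elim_swap, Sum.elim_swap] at h1
    exact h1 hH
  exact ⟨key, key⟩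

omit [Fintype σ] in
theorem Specializes.fst {p b : σ → ℂ} (h : Specializes (Sum.elim x y) (Sum.elim p b)) :
    Specializes x p := by
  intro f hf
  have h1 := h (rename Sum.inl f)
  rw [aeval_rename, aeval_rename, Sum.elim_comp_inl, Sum.elim_comp_inl] at h1
  exact h1 hf

omit [Fintype σ] in
theorem Specializes.snd {p b : σ → ℂ} (h : Specializes (Sum.elim x y) (Sum.elim p b)) :
    Specializes y b :=
  (specializes_sumElim_swap.1 h).fst

omit [Fintype σ] in
theorem exists_aeval_eq_aeval_smul_smul (s t : ℂ) (H : MvPolynomial (σ ⊕ σ) ℂ) :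
    ∃ H' : MvPolynomial (σ ⊕ σ) ℂ, ∀ {A : Type} [CommRing A] [Algebra ℂ A] (z w : σ → A),
      aeval (Sum.elim z w) H' = aeval (Sum.elim (s • z) (t • w)) H := by
  refine ⟨aeval (Sum.elim (fun i => C s * X (Sum.inl i)) (fun i => C t * X (Sum.inr i))) H, ?_⟩
  intro A _ _ z w
  change ((aeval (Sum.elim z w)).comp (aeval _)) H = _
  congr 1
  apply MvPolynomial.algHom_ext
  rintro (i | i) <;> simp [Algebra.smul_def]

/-- The conormal variety is invariant under the action of the two-dimensional torus. -/
theorem CutsOut.aeval_smul_smul_eq_zero (hS : CutsOut S x) (hxy : ConormalPair x y)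
    {p₀ : σ → ℂ} (hp₀ : Specializes x p₀)
    (hreg : Module.finrank ℂ (gradSpan S p₀) = Module.finrank E (conormalSpace x))
    {H : MvPolynomial (σ ⊕ σ) ℂ} (hH : aeval (Sum.elim x y) H = 0) {s t : ℂ} (hs : s ≠ 0) :
    aeval (Sum.elim (s • x) (t • y)) H = 0 := by
  obtain ⟨F, hFS, hliE, -, -⟩ := hp₀.exists_fin_gradSpan hreg
  have hF : ∀ j, aeval x (F j) = 0 := fun j => hS.aeval_eq_zero (hFS j)
  choose e he using fun j => hS.homog (F j) (hFS j)
  obtain ⟨H', hH'⟩ := exists_aeval_eq_aeval_smul_smul s t H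
  rw [← hH', hxy.aeval_eq_zero_iff hF hliE rfl]
  intro p hp c
  rw [hH']
  -- The gradient of `F j` scales by `s ^ (e j - 1)`; new coefficients absorb this and the factor
  -- `t`, so the scaled pair is again parametrized.
  have h := (hxy.aeval_eq_zero_iff hF hliE rfl H).1 hH (s • p) (hS.specializes_smul hp s)
    (fun j => t * (s ^ (e j - 1))⁻¹ * c j)
  have hc : t • gradComb F p c =
      gradComb F (s • p) (fun j => t * (s ^ (e j - 1))⁻¹ * c j) := by
    ext i
    simp only [gradComb, Pi.smul_apply, smul_eq_mul, Finset.mul_sum]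
    refine Finset.sum_congr rfl fun j _ => ?_
    rw [grad_smul_of_isHomogeneous (he j)]
    have : s ^ (e j - 1) ≠ 0 := pow_ne_zero _ hs
    simp only [Pi.smul_apply, smul_eq_mul]
    field_simp
  rw [hc]
  exact h

theorem CutsOut.specializes_smul_smul (hS : CutsOut S x) (hxy : ConormalPair x y)
    {p₀ : σ → ℂ} (hp₀ : Specializes x p₀)
    (hreg : Module.finrank ℂ (gradSpan S p₀) = Module.finrank E (conormalSpace x))
    {p b : σ → ℂ} (h : Specializes (Sum.elim x y) (Sum.elim p b)) {s : ℂ} (t : ℂ) (hs : s ≠ 0) :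
    Specializes (Sum.elim x y) (Sum.elim (s • p) (t • b)) := by
  intro H hH
  obtain ⟨H', hH'⟩ := exists_aeval_eq_aeval_smul_smul s t H
  rw [← hH']
  apply h
  rw [hH']
  exact hS.aeval_smul_smul_eq_zero hxy hp₀ hreg hH hs

/-- If the Jacobian matrix of `S` has generically the rank of the codimension, then this holds
outside a hypersurface. -/
theorem CutsOut.exists_forall_finrank_eq (hS : CutsOut S x)
    (hgen : Module.finrank E (gradSpan S x) = Module.finrank E (conormalSpace x)) :
    ∃ δ : MvPolynomial σ ℂ, aeval x δ ≠ 0 ∧ ∀ p, Specializes x p → aeval p δ ≠ 0 →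
      Module.finrank ℂ (gradSpan S p) = Module.finrank E (conormalSpace x) := by
  obtain ⟨F, hF, hli, -⟩ := exists_fin_linearIndependent (fun f => grad f x) S
  obtain ⟨c, hc⟩ := exists_det_ne_zero hli
  refine ⟨(Matrix.of fun i j => pderiv (c j) (F i)).det, ?_, fun p hp hδ => ?_⟩
  · rw [aeval_det]
    exact hc
  · rw [aeval_det] at hδ
    have hlip : LinearIndependent ℂ fun j => grad (F j) p :=
      linearIndependent_of_det_ne_zero c hδ
    refine le_antisymm (hS.finrank_gradSpan_le hp) ?_
    have hle : Submodule.span ℂ (Set.range fun j => grad (F j) p) ≤ gradSpan S p := by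
      refine Submodule.span_mono ?_
      rintro _ ⟨j, rfl⟩
      exact ⟨F j, hF j, rfl⟩
    have := Submodule.finrank_mono hle
    rw [finrank_span_eq_card hlip, Fintype.card_fin] at this
    rw [← hgen]
    exact this

theorem CutsOut.finrank_gradSpan_eq (hS : CutsOut S x) {p₀ : σ → ℂ} (hp₀ : Specializes x p₀)
    (hreg : Module.finrank ℂ (gradSpan S p₀) = Module.finrank E (conormalSpace x)) :
    Module.finrank E (gradSpan S x) = Module.finrank E (conormalSpace x) :=
  le_antisymm (Submodule.finrank_mono hS.gradSpan_le)
    (hreg ▸ finrank_gradSpan_le_of_specializes hp₀)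

end Regularity

/-! ### Projective points and the dual variety -/

section Projective

variable {σ : Type} [Fintype σ] {E : Type} [Field E] [Algebra ℂ E]
  {S : Set (MvPolynomial σ ℂ)} {x y : σ → E}

theorem tangentSpace_eq_perp (S : Set (MvPolynomial σ ℂ)) (p : PSpace σ) :
    tangentSpace S p = perp (gradSpan S p.rep) := by
  ext t
  rw [gradSpan, mem_perp_span]
  constructor
  · rintro h _ ⟨f, hf, rfl⟩
    exact h f hf
  · intro h f hf
    exact h _ ⟨f, hf, rfl⟩

theorem perpTangent_iff (S : Set (MvPolynomial σ ℂ)) (p : PSpace σ) (v : σ → ℂ) :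
    PerpTangent S p v ↔ v ∈ gradSpan S p.rep := by
  rw [PerpTangent, tangentSpace_eq_perp, ← perp_perp (gradSpan S p.rep), perp_perp, mem_perp]
  refine forall₂_congr fun t _ => ?_
  rw [dotProduct_comm]
  rfl

/-- Rank-nullity turns the condition on the tangent dimension into Jacobian rank equal to
codimension. -/
theorem CutsOut.isRegularPoint_iff [Algebra.EssFiniteType ℂ E] (hS : CutsOut S x) (p : PSpace σ) :
    IsRegularPoint S p ↔ Specializes x p.rep ∧
      Module.finrank ℂ (gradSpan S p.rep) = Module.finrank E (conormalSpace x) := by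
  obtain ⟨d, -, hd1, hd2⟩ := exists_finrank_conormalSpace_add x
  have h := finrank_add_finrank_perp (gradSpan S p.rep)
  rw [IsRegularPoint, hS.ringKrullDim_eq, hd1, tangentSpace_eq_perp,
    ← hS.forall_aeval_eq_zero_iff]
  refine and_congr Iff.rfl ?_
  rw [show ((Module.finrank ℂ (perp (gradSpan S p.rep)) : ℕ) : WithBot ℕ∞) = (d : WithBot ℕ∞) ↔
    Module.finrank ℂ (perp (gradSpan S p.rep)) = d by norm_cast]
  omega

theorem CutsOut.specializes_smul_iff (hS : CutsOut S x) {p : σ → ℂ} {t : ℂ} (ht : t ≠ 0) :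
    Specializes x (t • p) ↔ Specializes x p := by
  refine ⟨fun h => ?_, fun h => hS.specializes_smul h t⟩
  have := hS.specializes_smul h t⁻¹
  rwa [smul_smul, inv_mul_cancel₀ ht, one_smul] at this

omit [Fintype σ] in
theorem exists_mk_rep_eq (v : σ → ℂ) (hv : v ≠ 0) :
    ∃ a : ℂ, a ≠ 0 ∧ (Projectivization.mk ℂ v hv).rep = a • v := by
  obtain ⟨a, ha⟩ := Projectivization.exists_smul_eq_mk_rep ℂ v hv
  exact ⟨a, a.ne_zero, ha.symm⟩

theorem CutsOut.isRegularPoint_mk_iff [Algebra.EssFiniteType ℂ E] (hS : CutsOut S x)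
    (v : σ → ℂ) (hv : v ≠ 0) :
    IsRegularPoint S (Projectivization.mk ℂ v hv) ↔ Specializes x v ∧
      Module.finrank ℂ (gradSpan S v) = Module.finrank E (conormalSpace x) := by
  obtain ⟨a, ha, hrep⟩ := exists_mk_rep_eq v hv
  rw [hS.isRegularPoint_iff, hrep, gradSpan_smul hS.homog _ ha, hS.specializes_smul_iff ha]

theorem isBihomog_rename_inr {f : MvPolynomial σ ℂ} {d : ℕ} (hf : f.IsHomogeneous d) :
    IsBihomog (rename Sum.inr f : MvPolynomial (σ ⊕ σ) ℂ) := by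
  refine ⟨0, d, fun m hm => ?_⟩
  obtain ⟨u, rfl, hu⟩ := coeff_rename_ne_zero _ _ _ hm
  have h := hf hu
  rw [Finsupp.weight_apply] at h ⊢
  rw [Finsupp.sum_mapDomain_index (by simp) (by intros; rw [add_smul])]
  rw [Finsupp.sum_fintype _ _ (by simp)] at h ⊢
  ext
  · simp [Prod.fst_sum]
  · simpa [Prod.snd_sum] using h

omit [Fintype σ] in
theorem subset_biClosure (Z : Set (PSpace σ × PSpace σ)) : Z ⊆ biClosure Z :=
  fun _ hz _ _ hF => hF _ hz

/-- The constant `1`, of bidegree `(0, 0)`, vanishes on the empty set of regular conormal pairs, so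
their closure is empty. -/
theorem dualEquations_eq_of_forall_not_isRegularPoint (h : ∀ p, ¬ IsRegularPoint S p) :
    (1 : MvPolynomial σ ℂ) ∈ dualEquations S := by
  refine ⟨⟨0, isHomogeneous_one _ _⟩, ?_⟩
  rintro _ ⟨⟨p, b⟩, hz, rfl⟩
  exfalso
  have := hz 1 ⟨0, 0, isWeightedHomogeneous_one _ _⟩ (fun z hz => absurd hz.1 (h _))
  simp at this

/-- The dual variety is the closure of the second component of the generic conormal pair. -/
theorem CutsOut.mem_dualEquations_iff (hS : CutsOut S x) (hxy : ConormalPair x y)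
    {p₀ : PSpace σ} (hp₀ : IsRegularPoint S p₀) {j₀ : σ} (hy : y j₀ ≠ 0) (f : MvPolynomial σ ℂ) :
    f ∈ dualEquations S ↔ IsHomog f ∧ aeval y f = 0 := by
  have := hxy.essFiniteType
  obtain ⟨hp₀s, hp₀r⟩ := (hS.isRegularPoint_iff p₀).1 hp₀
  constructor
  · rintro ⟨hf, hvan⟩
    refine ⟨hf, ?_⟩
    obtain ⟨d, hd⟩ := hf
    obtain ⟨i₀, hi₀⟩ := Function.ne_iff.1 p₀.rep_nonzero
    have hx : x i₀ ≠ 0 := by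
      intro h0
      have := hp₀s (X i₀) (by rwa [aeval_X])
      rw [aeval_X] at this
      exact hi₀ this
    obtain ⟨δ, hδ, hδreg⟩ := hS.exists_forall_finrank_eq (hS.finrank_gradSpan_eq hp₀s hp₀r)
    obtain ⟨F, hFS, hliE, -, -⟩ := hp₀s.exists_fin_gradSpan (S := S) hp₀r
    have hF : ∀ j, aeval x (F j) = 0 := fun j => hS.aeval_eq_zero (hFS j)
    -- The extra factors restrict attention to regular `p` with `p` and `b` nonzero, which define
    -- projective points. All three are nonzero at the generic pair and cancel at the end.
    let H : MvPolynomial (σ ⊕ σ) ℂ :=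
      rename Sum.inl (δ * X i₀) * rename Sum.inr (X j₀ * f)
    have hH : ∀ {A : Type} [CommRing A] [Algebra ℂ A] (z w : σ → A),
        aeval (Sum.elim z w) H = (aeval z δ * z i₀) * (w j₀ * aeval w f) := by
      intro A _ _ z w
      simp only [H, map_mul, aeval_rename, Sum.elim_comp_inl, Sum.elim_comp_inr, aeval_X,
        rename_X, Sum.elim_inl, Sum.elim_inr]
    have h0 : aeval (Sum.elim x y) H = 0 := by
      rw [hxy.aeval_eq_zero_iff hF hliE rfl]
      intro p hp c
      rw [hH]
      by_contra hne
      have hδp : aeval p δ ≠ 0 := fun h => hne (by rw [h]; ring)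
      have hpi : p i₀ ≠ 0 := fun h => hne (by rw [h]; ring)
      set b := gradComb F p c
      have hbj : b j₀ ≠ 0 := fun h => hne (by rw [h]; ring)
      have hfb : aeval b f ≠ 0 := fun h => hne (by rw [h]; ring)
      have hpne : p ≠ 0 := fun h => hpi (by rw [h]; rfl)
      have hbne : b ≠ 0 := fun h => hbj (by rw [h]; rfl)
      obtain ⟨s, hs, hsrep⟩ := exists_mk_rep_eq p hpne
      obtain ⟨t, ht, htrep⟩ := exists_mk_rep_eq b hbne
      have hb : b ∈ gradSpan S p := by
        have : b = ∑ j, c j • grad (F j) p := by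
          ext i
          simp [b, gradComb]
        rw [this]
        exact Submodule.sum_mem _ fun j _ => Submodule.smul_mem _ _
          (Submodule.subset_span ⟨F j, hFS j, rfl⟩)
      have hmem : Projectivization.mk ℂ b hbne ∈ dualVariety S := by
        refine ⟨(Projectivization.mk ℂ p hpne, Projectivization.mk ℂ b hbne),
          subset_biClosure _ ⟨?_, ?_⟩, rfl⟩
        · exact (hS.isRegularPoint_mk_iff p hpne).2 ⟨hp, hδreg p hp hδp⟩
        · rw [perpTangent_iff, hsrep, htrep, gradSpan_smul hS.homog _ hs]
          exact Submodule.smul_mem _ _ hb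
      have h1 : aeval (Projectivization.mk ℂ b hbne).rep f = 0 := hvan _ hmem
      rw [htrep, aeval_smul_of_isHomogeneous hd, smul_eq_mul, mul_eq_zero] at h1
      exact hfb (h1.resolve_left (pow_ne_zero _ ht))
    rw [hH, mul_eq_zero, mul_eq_zero, mul_eq_zero] at h0
    tauto
  · rintro ⟨⟨d, hd⟩, h0⟩
    refine ⟨⟨d, hd⟩, ?_⟩
    rintro _ ⟨⟨p, b⟩, hz, rfl⟩
    have h1 := hz (rename Sum.inr f) (isBihomog_rename_inr hd) (by
      rintro ⟨p', b'⟩ ⟨hp', hb'⟩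
      obtain ⟨hs, hr⟩ := (hS.isRegularPoint_iff p').1 hp'
      rw [perpTangent_iff, ← hS.specializes_iff_mem_gradSpan hxy hs hr] at hb'
      rw [eval_rename, Sum.elim_comp_inr]
      exact hb'.snd f h0)
    rwa [eval_rename, Sum.elim_comp_inr] at h1

/-- The ideal of `y` is homogeneous because scaling the second factor alone preserves the ideal of
the pair. -/
theorem CutsOut.aeval_homogeneousComponent_right (hS : CutsOut S x) (hxy : ConormalPair x y)
    {p₀ : σ → ℂ} (hp₀ : Specializes x p₀)
    (hreg : Module.finrank ℂ (gradSpan S p₀) = Module.finrank E (conormalSpace x))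
    {f : MvPolynomial σ ℂ} (hf : aeval y f = 0) (d : ℕ) :
    aeval y (homogeneousComponent d f) = 0 := by
  refine aeval_homogeneousComponent_eq_zero (fun t _ => ?_) d
  have := hS.aeval_smul_smul_eq_zero hxy hp₀ hreg (H := rename Sum.inr f) (s := 1) (t := t)
    (by rwa [aeval_rename, Sum.elim_comp_inr]) one_ne_zero
  rwa [aeval_rename, Sum.elim_comp_inr] at this

theorem CutsOut.dual (hS : CutsOut S x) (hxy : ConormalPair x y)
    {p₀ : PSpace σ} (hp₀ : IsRegularPoint S p₀) {j₀ : σ} (hy : y j₀ ≠ 0) :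
    CutsOut (dualEquations S) y := by
  have := hxy.essFiniteType
  obtain ⟨hp₀s, hp₀r⟩ := (hS.isRegularPoint_iff p₀).1 hp₀
  have hmem := hS.mem_dualEquations_iff hxy hp₀ hy
  refine ⟨fun f hf => hf.1, fun b => ⟨fun h f hf => ?_, fun h f hf => h f ((hmem f).1 hf).2⟩⟩
  rw [← sum_homogeneousComponent f, map_sum]
  refine Finset.sum_eq_zero fun d _ => h _ ((hmem _).2 ⟨⟨d, ?_⟩, ?_⟩)
  · exact homogeneousComponent_isHomogeneous d f
  · exact hS.aeval_homogeneousComponent_right hxy hp₀s hp₀r hf d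

/-- The scheme defined by the equations of the dual variety is generically reduced. -/
theorem CutsOut.gradSpan_dualEquations (hS : CutsOut S x) (hxy : ConormalPair x y)
    {p₀ : PSpace σ} (hp₀ : IsRegularPoint S p₀) {j₀ : σ} (hy : y j₀ ≠ 0) :
    gradSpan (dualEquations S) y = conormalSpace y := by
  have := hxy.essFiniteType
  obtain ⟨hp₀s, hp₀r⟩ := (hS.isRegularPoint_iff p₀).1 hp₀
  have hmem := hS.mem_dualEquations_iff hxy hp₀ hy
  refine le_antisymm (hS.dual hxy hp₀ hy).gradSpan_le (Submodule.span_le.2 ?_)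
  rintro _ ⟨f, hf, rfl⟩
  -- Forms suffice: the homogeneous components of `f` vanish at `y` too.
  have : grad f y = ∑ d ∈ Finset.range (f.totalDegree + 1), grad (homogeneousComponent d f) y := by
    conv_lhs => rw [← sum_homogeneousComponent f]
    ext i
    simp [grad]
  rw [this]
  refine Submodule.sum_mem _ fun d _ => Submodule.subset_span ⟨_, (hmem _).2 ⟨⟨d, ?_⟩, ?_⟩, rfl⟩
  · exact homogeneousComponent_isHomogeneous d f
  · exact hS.aeval_homogeneousComponent_right hxy hp₀s hp₀r hf d

end Projective

/-! ### An equation for the products of coordinates -/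

section Generic

variable {σ : Type} [Fintype σ] {E : Type} [Field E] [Algebra ℂ E]

theorem aeval_eq_eval₂_optionEquivLeft {κ A : Type} [CommRing A] [Algebra ℂ A] (g : Option κ → A)
    (Φ : MvPolynomial (Option κ) ℂ) :
    aeval g Φ = Polynomial.eval₂ (aeval (g ∘ some) : MvPolynomial κ ℂ →ₐ[ℂ] A).toRingHom (g none)
      (optionEquivLeft ℂ κ Φ) := by
  induction Φ using MvPolynomial.induction_on with
  | C a => simp [optionEquivLeft_C]
  | add p q hp hq => rw [map_add, map_add, Polynomial.eval₂_add, hp, hq]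
  | mul_X p i hp =>
    rw [map_mul, map_mul, Polynomial.eval₂_mul, hp]
    congr 1
    cases i <;> simp [optionEquivLeft_X_none, optionEquivLeft_X_some]

/-- The products of the coordinates of the two components of the points of a proper closed subset
of the conormal variety satisfy a nontrivial equation. -/
theorem ConormalPair.exists_forall_eval_mul_eq_zero {x y : σ → E} (hxy : ConormalPair x y)
    {κ : Type} [Fintype κ] (ι : κ → σ) (hκ : Fintype.card κ + 1 = Fintype.card σ) (i₀ : σ)
    {h : MvPolynomial (σ ⊕ σ) ℂ} (hh : aeval (Sum.elim x y) h ≠ 0) :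
    ∃ G : MvPolynomial κ ℂ, G ≠ 0 ∧ ∀ p b : σ → ℂ, p i₀ ≠ 0 →
      (∀ t : ℂ, t ≠ 0 → Specializes (Sum.elim x y) (Sum.elim (t • p) (t⁻¹ • b)) ∧
        aeval (Sum.elim (t • p) (t⁻¹ • b)) h = 0) →
      eval (fun k => p (ι k) * b (ι k)) G = 0 := by
  let gP : Option (Option κ) → MvPolynomial (σ ⊕ σ) ℂ := fun o => o.elim h fun o =>
    o.elim (X (Sum.inl i₀)) fun k => X (Sum.inl (ι k)) * X (Sum.inr (ι k))
  let g : Option (Option κ) → E := fun o => aeval (Sum.elim x y) (gP o)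
  -- There are `card κ + 2 = card σ + 1` elements in a field of transcendence degree `card σ`.
  have hdep : ¬ AlgebraicIndependent ℂ g := by
    intro hg
    have := hg.cardinalMk_le_trdeg
    rw [hxy.trdeg_eq, Cardinal.mk_fintype] at this
    have h2 : Fintype.card (Option (Option κ)) ≤ Fintype.card σ := by exact_mod_cast this
    rw [Fintype.card_option, Fintype.card_option] at h2
    omega
  rw [algebraicIndependent_iff] at hdep
  push Not at hdep
  obtain ⟨Φ, hΦ, hΦ0⟩ := hdep
  -- Splitting off the full power of the variable for `h`, which is nonzero at the generic pair,
  -- leaves a relation `q` that stays nontrivial when `h` is set to zero.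
  obtain ⟨q, hq, hqdvd⟩ := Polynomial.exists_eq_pow_rootMultiplicity_mul_and_not_dvd
    (optionEquivLeft ℂ (Option κ) Φ)
    (by rwa [Ne, map_eq_zero_iff _ (optionEquivLeft ℂ (Option κ)).injective]) 0
  rw [Polynomial.C_0, sub_zero] at hq hqdvd
  have hΨ0 : q.coeff 0 ≠ 0 := by rwa [Ne, ← Polynomial.X_dvd_iff]
  have hqE : Polynomial.eval₂ (aeval (g ∘ some) : MvPolynomial (Option κ) ℂ →ₐ[ℂ] E).toRingHom
      (g none) q = 0 := by
    rw [aeval_eq_eval₂_optionEquivLeft, hq, Polynomial.eval₂_mul, Polynomial.eval₂_pow,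
      Polynomial.eval₂_X, mul_eq_zero] at hΦ
    exact hΦ.resolve_left (pow_ne_zero _ hh)
  let Φ' := (optionEquivLeft ℂ (Option κ)).symm q
  have hΦ'E : aeval g Φ' = 0 := by
    rw [aeval_eq_eval₂_optionEquivLeft, AlgEquiv.apply_symm_apply, hqE]
  have hcomp : ∀ {A : Type} [CommRing A] [Algebra ℂ A] (z : σ ⊕ σ → A),
      aeval z (aeval gP Φ') = aeval (fun o => aeval z (gP o)) Φ' := by
    intro A _ _ z
    change ((aeval z).comp (aeval gP)) Φ' = _
    congr 1
    apply MvPolynomial.algHom_ext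
    intro o
    simp
  let θ := optionEquivLeft ℂ κ (q.coeff 0)
  have hθ : θ ≠ 0 := by rwa [Ne, map_eq_zero_iff _ (optionEquivLeft ℂ κ).injective]
  -- `θ` is a polynomial in the variable for `p i₀`. Scaling to `(t • p, t⁻¹ • b)` fixes the
  -- products but moves `p i₀` through infinitely many roots, so all coefficients vanish.
  refine ⟨θ.leadingCoeff, Polynomial.leadingCoeff_ne_zero.2 hθ, fun p b hp hz => ?_⟩
  let φ : MvPolynomial κ ℂ →+* ℂ := (aeval fun k => p (ι k) * b (ι k) :
    MvPolynomial κ ℂ →ₐ[ℂ] ℂ).toRingHom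
  have hroot : ∀ t : ℂ, t ≠ 0 → Polynomial.eval (t * p i₀) (θ.map φ) = 0 := by
    intro t ht
    obtain ⟨hs, h0⟩ := hz t ht
    have h1 := hs (aeval gP Φ') (by rw [hcomp]; exact hΦ'E)
    rw [hcomp, aeval_eq_eval₂_optionEquivLeft, AlgEquiv.apply_symm_apply] at h1
    change Polynomial.eval₂ _ (aeval _ h) q = 0 at h1
    rw [h0, Polynomial.eval₂_at_zero] at h1
    change aeval _ (q.coeff 0) = 0 at h1
    rw [aeval_eq_eval₂_optionEquivLeft] at h1
    have hg1 : ((fun o => aeval (Sum.elim (t • p) (t⁻¹ • b)) (gP o)) ∘ some) ∘ some =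
        fun k => p (ι k) * b (ι k) := by
      funext k
      simp only [gP, Function.comp_apply, Option.elim_some, map_mul, aeval_X, Sum.elim_inl,
        Sum.elim_inr, Pi.smul_apply, smul_eq_mul]
      field_simp
    have hg2 : ((fun o => aeval (Sum.elim (t • p) (t⁻¹ • b)) (gP o)) ∘ some) none =
        t * p i₀ := by
      simp [gP]
    rw [hg1, hg2] at h1
    rw [Polynomial.eval_map]
    exact h1
  have hzero : θ.map φ = 0 := by
    refine Polynomial.eq_zero_of_infinite_isRoot _ ?_
    refine Set.Infinite.mono (s := (fun t => t * p i₀) '' {0}ᶜ) ?_ ?_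
    · rintro _ ⟨t, ht, rfl⟩
      exact hroot t ht
    · exact (Set.infinite_of_finite_compl (by simp)).image (mul_left_injective₀ hp).injOn
  have := congrArg (fun r => Polynomial.coeff r θ.natDegree) hzero
  simp only [Polynomial.coeff_map, Polynomial.coeff_zero] at this
  exact this

end Generic

/-! ### Affine cones of irreducible varieties -/

section Cones

variable {σ : Type} [Fintype σ] {S : Set (MvPolynomial σ ℂ)}

/-- The affine cone over the projective scheme defined by `S`. -/
def cone (S : Set (MvPolynomial σ ℂ)) : Set (σ → ℂ) := {v | ∀ f ∈ S, aeval v f = 0}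

theorem smul_mem_cone (hS : ∀ f ∈ S, IsHomog f) {v : σ → ℂ} (hv : v ∈ cone S) (t : ℂ) :
    t • v ∈ cone S := by
  intro f hf
  obtain ⟨d, hd⟩ := hS f hf
  rw [aeval_smul_of_isHomogeneous hd, hv f hf, smul_zero]

theorem homogeneousComponent_mem_vanishingIdeal_cone (hS : ∀ f ∈ S, IsHomog f)
    {h : MvPolynomial σ ℂ} (hh : h ∈ vanishingIdeal ℂ (cone S)) (d : ℕ) :
    homogeneousComponent d h ∈ vanishingIdeal ℂ (cone S) := fun _ hv =>
  aeval_homogeneousComponent_eq_zero (fun t _ => hh _ (smul_mem_cone hS hv t)) d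

theorem vanishingIdeal_cone (S : Set (MvPolynomial σ ℂ)) :
    vanishingIdeal ℂ (cone S) = (Ideal.span S).radical := by
  rw [← vanishingIdeal_zeroLocus_eq_radical (K := ℂ), zeroLocus_span]
  rfl

/-- An irreducible projective variety has a prime ideal. -/
theorem isPrime_vanishingIdeal_cone (hS : ∀ f ∈ S, IsHomog f) (hirr : IsIrred (zeroLocus S)) :
    (vanishingIdeal ℂ (cone S)).IsPrime := by
  obtain ⟨⟨p₀, hp₀⟩, hirr⟩ := hirr
  have key : ∀ a : MvPolynomial σ ℂ, IsHomog a →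
      zeroLocus S ⊆ zeroLocus {a} → a ∈ vanishingIdeal ℂ (cone S) := by
    rintro a ⟨d, hd⟩ ha v hv
    -- The vertex is not a projective point; it is reached as `0 • p₀.rep`, which also handles
    -- constants.
    by_cases hv0 : v = 0
    · have h1 : aeval p₀.rep a = 0 := ha hp₀ a rfl
      have h2 := aeval_smul_of_isHomogeneous hd 0 p₀.rep
      rw [zero_smul, h1, smul_zero] at h2
      rwa [hv0]
    · obtain ⟨t, ht, hrep⟩ := exists_mk_rep_eq v hv0
      have hmem : Projectivization.mk ℂ v hv0 ∈ zeroLocus S := by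
        intro f hf
        rw [hrep]
        exact smul_mem_cone hS hv t f hf
      have h1 : aeval (Projectivization.mk ℂ v hv0).rep a = 0 := ha hmem a rfl
      rw [hrep, aeval_smul_of_isHomogeneous hd, smul_eq_mul, mul_eq_zero] at h1
      exact h1.resolve_left (pow_ne_zero _ ht)
  let : GradedAlgebra (homogeneousSubmodule σ ℂ) := gradedAlgebra
  have hhomI : (vanishingIdeal ℂ (cone S)).IsHomogeneous (homogeneousSubmodule σ ℂ) := by
    intro d h hh
    have := homogeneousComponent_mem_vanishingIdeal_cone hS hh d
    rwa [← decomposition.decompose'_apply] at this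
  -- Primality of a homogeneous ideal may be tested on forms, where it is irreducibility against two
  -- hypersurfaces.
  refine hhomI.isPrime_of_homogeneous_mem_or_mem ?_ ?_
  · rw [Ne, Ideal.eq_top_iff_one]
    intro h1
    have := h1 p₀.rep hp₀
    simp at this
  · rintro a b ⟨d, hd⟩ ⟨e, he⟩ hab
    have hd' : IsHomog a := ⟨d, hd⟩
    have he' : IsHomog b := ⟨e, he⟩
    have hsub : zeroLocus S ⊆ zeroLocus {a} ∪ zeroLocus {b} := by
      intro p hp
      have := hab p.rep hp
      rw [map_mul, mul_eq_zero] at this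
      refine this.imp (fun h f hf => ?_) (fun h f hf => ?_)
      · rw [Set.mem_singleton_iff.1 hf]
        exact h
      · rw [Set.mem_singleton_iff.1 hf]
        exact h
    refine (hirr _ _ ⟨{a}, ?_, rfl⟩ ⟨{b}, ?_, rfl⟩ hsub).imp (key a hd') (key b he')
    · rintro _ rfl
      exact hd'
    · rintro _ rfl
      exact he'

/-- The generic conormal pair of an irreducible projective variety with a regular point. -/
theorem exists_conormalPair_cutsOut (hS : ∀ f ∈ S, IsHomog f)
    (hprime : (vanishingIdeal ℂ (cone S)).IsPrime) {p₀ : PSpace σ} (hp₀ : IsRegularPoint S p₀) :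
    ∃ (E : Type) (_ : Field E) (_ : Algebra ℂ E) (x y : σ → E),
      CutsOut S x ∧ ConormalPair x y := by
  obtain ⟨d, hd, -⟩ := exists_ringKrullDim_eq_trdeg ℂ (MvPolynomial σ ℂ ⧸ vanishingIdeal ℂ (cone S))
  have hdim : ringKrullDim (MvPolynomial σ ℂ ⧸ Ideal.span S) = (d : WithBot ℕ∞) := by
    rw [← hd, ringKrullDim_quotient, ringKrullDim_quotient, vanishingIdeal_cone,
      PrimeSpectrum.zeroLocus_radical]
  obtain ⟨hp₀S, hp₀d⟩ := hp₀
  rw [hdim, tangentSpace_eq_perp] at hp₀d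
  have hp₀d' : Module.finrank ℂ (perp (gradSpan S p₀.rep)) = d := by exact_mod_cast hp₀d
  -- Regularity of `p₀` makes the number of these independent gradients the codimension.
  obtain ⟨F, hF, hli, -⟩ := exists_fin_linearIndependent (fun f => grad f p₀.rep) S
  have hsub : ∀ f ∈ S, f ∈ vanishingIdeal ℂ (cone S) := fun f hf v hv => hv f hf
  obtain ⟨E, hE1, hE2, x, y, hx, hxy⟩ := exists_conormalPair
    (fun h hh e => homogeneousComponent_mem_vanishingIdeal_cone hS hh e)
    (fun j => hsub _ (hF j)) hd
    (by rw [← finrank_add_finrank_perp (gradSpan S p₀.rep), hp₀d']; rfl)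
    (p := p₀.rep) (fun h hh => hh _ hp₀S) hli
  have hx' : ∀ f, aeval x f = 0 ↔ f ∈ vanishingIdeal ℂ (cone S) := fun f => by rw [← hx]; rfl
  refine ⟨E, hE1, hE2, x, y, ⟨hS, fun p => ⟨fun hp f hf => ?_, fun hp f hf => ?_⟩⟩, hxy⟩
  · exact (hx' f).1 hf p hp
  · exact hp f ((hx' f).2 (hsub f hf))

end Cones

/-! ### The variety `X'` in the hyperplane `p_s = p_0 + ⋯ + p_n` -/

section PrimeEquations

variable {n k : ℕ} {f : Fin k → MvPolynomial (Fin (n + 1)) ℂ}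

theorem isHomog_primeEquations (hhom : ∀ j, IsHomog (f j)) :
    ∀ g ∈ primeEquations f, IsHomog g := by
  rintro _ (⟨j, rfl⟩ | rfl)
  · obtain ⟨d, hd⟩ := hhom j
    exact ⟨d, hd.rename_isHomogeneous⟩
  · exact ⟨1, (isHomogeneous_X _ _).sub (IsHomogeneous.sum _ _ _ fun i _ => isHomogeneous_X _ _)⟩

/-- The point of the hyperplane `p_s = p_0 + ⋯ + p_n` over a given point. -/
def addSum (v : Fin (n + 1) → ℂ) : Fin (n + 2) → ℂ :=
  Fin.snoc (α := fun _ => ℂ) v (∑ i, v i)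

theorem mem_cone_primeEquations_iff (v : Fin (n + 2) → ℂ) :
    v ∈ cone (primeEquations f) ↔ ∃ w ∈ cone (Set.range f), v = addSum w := by
  constructor
  · intro hv
    refine ⟨v ∘ Fin.castSucc, ?_, ?_⟩
    · rintro _ ⟨j, rfl⟩
      have := hv _ (Or.inl ⟨j, rfl⟩)
      rwa [aeval_rename] at this
    · have := hv _ (Or.inr rfl)
      simp only [map_sub, aeval_X, map_sum, sub_eq_zero] at this
      funext i
      refine Fin.lastCases ?_ (fun i => ?_) i
      · simpa [addSum] using this
      · simp [addSum]
  · rintro ⟨w, hw, rfl⟩ g (⟨j, rfl⟩ | rfl)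
    · rw [aeval_rename]
      have : addSum w ∘ Fin.castSucc = w := by
        funext i
        simp [addSum]
      rw [this]
      exact hw _ ⟨j, rfl⟩
    · simp [addSum]

/-- The cone of `X'` is the graph of a linear form over that of `X`, so its ideal is the preimage of
a prime under substitution for the last variable. -/
theorem isPrime_vanishingIdeal_primeEquations (hhom : ∀ j, IsHomog (f j))
    (hirr : IsIrred (zeroLocus (Set.range f))) :
    (vanishingIdeal ℂ (cone (primeEquations f))).IsPrime := by
  have hP := isPrime_vanishingIdeal_cone (S := Set.range f)
    (by rintro _ ⟨j, rfl⟩; exact hhom j) hirr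
  let ψ : MvPolynomial (Fin (n + 2)) ℂ →ₐ[ℂ] MvPolynomial (Fin (n + 1)) ℂ :=
    aeval (Fin.snoc (α := fun _ => MvPolynomial (Fin (n + 1)) ℂ) X (∑ i, X i))
  have hψ : ∀ (w : Fin (n + 1) → ℂ) h, aeval w (ψ h) = aeval (addSum w) h := by
    intro w h
    change ((aeval w).comp ψ) h = _
    congr 1
    apply MvPolynomial.algHom_ext
    intro i
    refine Fin.lastCases ?_ (fun i => ?_) i
    · simp [ψ, addSum]
    · simp [ψ, addSum]
  have : vanishingIdeal ℂ (cone (primeEquations f)) =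
      (vanishingIdeal ℂ (cone (Set.range f))).comap ψ := by
    ext h
    rw [Ideal.mem_comap, mem_vanishingIdeal_iff, mem_vanishingIdeal_iff]
    constructor
    · intro hh w hw
      rw [hψ]
      exact hh _ ((mem_cone_primeEquations_iff _).2 ⟨w, hw, rfl⟩)
    · intro hh v hv
      obtain ⟨w, hw, rfl⟩ := (mem_cone_primeEquations_iff v).1 hv
      rw [← hψ]
      exact hh w hw
  rw [this]
  exact Ideal.comap_isPrime _ _

/-- The linear equation has last partial derivative `1` everywhere. This later shows that the dual
generic point is nonzero. -/
theorem exists_mem_gradSpan_primeEquations (p : Fin (n + 2) → ℂ) :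
    ∃ b ∈ gradSpan (primeEquations f) p, b (Fin.last (n + 1)) ≠ 0 := by
  refine ⟨_, Submodule.subset_span ⟨_, Or.inr rfl, rfl⟩, ?_⟩
  have : ∀ i : Fin (n + 1), Fin.castSucc i ≠ Fin.last (n + 1) := fun i =>
    (Fin.castSucc_lt_last i).ne
  simp [grad, pderiv_X, this]

end PrimeEquations

/-! ### Critical points and their partners -/

section CriticalPoints

variable {σ : Type} [Fintype σ] {E : Type} [Field E] [Algebra ℂ E]
  {S S' : Set (MvPolynomial σ ℂ)} {x y : σ → E} {w : σ → ℂ}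

omit [Fintype σ] in
theorem ProductRel.symm {p b : PSpace σ} (h : ProductRel w p b) : ProductRel w b p := by
  obtain ⟨c, hc, h⟩ := h
  exact ⟨c, hc, fun i => by rw [mul_comm, h]⟩

/-- The relation makes `b` a multiple of the logarithmic gradient `w i / p i`. -/
theorem isCriticalPoint_iff_mem_gradSpan (hw : ∀ i, w i ≠ 0) {p b : PSpace σ}
    (h : ProductRel w p b) (hp : IsRegularPoint S p) :
    IsCriticalPoint S w p ↔ b.rep ∈ gradSpan S p.rep := by
  obtain ⟨c, hc, h⟩ := h
  have hne : ∀ i, p.rep i ≠ 0 := fun i h0 => by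
    have := h i
    rw [h0, zero_mul] at this
    exact mul_ne_zero hc (hw i) this.symm
  have hb : b.rep = c • fun i => w i / p.rep i := by
    ext i
    have := hne i
    simp only [Pi.smul_apply, smul_eq_mul]
    field_simp
    rw [mul_comm, h i]
  rw [hb, Submodule.smul_mem_iff _ hc, ← perpTangent_iff]
  exact ⟨fun h => h.2.2, fun h => ⟨hp, hne, h⟩⟩

/-- Critical points on a variety and on its dual correspond to each other. -/
theorem isCriticalPoint_iff_of_productRel (hS : CutsOut S x) (hS' : CutsOut S' y)
    (hxy : ConormalPair x y) (hw : ∀ i, w i ≠ 0) {p b : PSpace σ} (h : ProductRel w p b)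
    (hp : IsRegularPoint S p) (hb : IsRegularPoint S' b) :
    IsCriticalPoint S w p ↔ IsCriticalPoint S' w b := by
  have := hxy.essFiniteType
  rw [isCriticalPoint_iff_mem_gradSpan hw h hp, isCriticalPoint_iff_mem_gradSpan hw h.symm hb]
  obtain ⟨hp1, hp2⟩ := (hS.isRegularPoint_iff p).1 hp
  obtain ⟨hb1, hb2⟩ := (hS'.isRegularPoint_iff b).1 hb
  rw [← hS.specializes_iff_mem_gradSpan hxy hp1 hp2,
    ← hS'.specializes_iff_mem_gradSpan hxy.symm hb1 hb2, specializes_sumElim_swap]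

/-- A point of the conormal variety with generic coordinatewise product has regular components. -/
theorem exists_forall_finrank_eq_of_eval_ne_zero (hS : CutsOut S x) (hS' : CutsOut S' y)
    (hxy : ConormalPair x y) {p₀ : PSpace σ} (hp₀ : IsRegularPoint S p₀)
    (hgen : gradSpan S' y = conormalSpace y)
    {κ : Type} [Fintype κ] (ι : κ → σ) (hκ : Fintype.card κ + 1 = Fintype.card σ) (i₀ : σ) :
    ∃ G : MvPolynomial κ ℂ, G ≠ 0 ∧ ∀ p b : σ → ℂ,
      Specializes (Sum.elim x y) (Sum.elim p b) → p i₀ ≠ 0 →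
      eval (fun k => p (ι k) * b (ι k)) G ≠ 0 →
      Module.finrank ℂ (gradSpan S p) = Module.finrank E (conormalSpace x) ∧
      Module.finrank ℂ (gradSpan S' b) = Module.finrank E (conormalSpace y) := by
  have := hxy.essFiniteType
  obtain ⟨hp₀s, hp₀r⟩ := (hS.isRegularPoint_iff p₀).1 hp₀
  obtain ⟨δ, hδ, hδreg⟩ := hS.exists_forall_finrank_eq (hS.finrank_gradSpan_eq hp₀s hp₀r)
  obtain ⟨ε, hε, hεreg⟩ := hS'.exists_forall_finrank_eq (by rw [hgen])
  have hh : ∀ {A : Type} [CommRing A] [Algebra ℂ A] (z w : σ → A),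
      aeval (Sum.elim z w) (rename Sum.inl δ * rename Sum.inr ε : MvPolynomial (σ ⊕ σ) ℂ) =
        aeval z δ * aeval w ε := by
    intro A _ _ z w
    rw [map_mul, aeval_rename, aeval_rename, Sum.elim_comp_inl, Sum.elim_comp_inr]
  obtain ⟨G, hG, hGz⟩ := hxy.exists_forall_eval_mul_eq_zero ι hκ i₀
    (h := rename Sum.inl δ * rename Sum.inr ε) (by rw [hh]; exact mul_ne_zero hδ hε)
  refine ⟨G, hG, fun p b hpb hp hne => ?_⟩
  -- Jacobian ranks are constant along torus orbits, so one irregular component makes the product of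
  -- `δ` and `ε` vanish on the whole orbit.
  by_contra hbad
  refine hne (hGz p b hp fun t ht => ?_)
  have hpbt := hS.specializes_smul_smul hxy hp₀s hp₀r hpb t⁻¹ ht
  refine ⟨hpbt, ?_⟩
  rw [hh]
  by_contra h0
  refine hbad ⟨?_, ?_⟩
  · rw [← hδreg _ hpbt.fst (left_ne_zero_of_mul h0), gradSpan_smul hS.homog _ ht]
  · rw [← hεreg _ hpbt.snd (right_ne_zero_of_mul h0), gradSpan_smul hS'.homog _ (inv_ne_zero ht)]

/-- A critical point whose coordinatewise quotient vector is regular on the dual variety has a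
partner there. -/
theorem IsCriticalPoint.exists_productRel [Nonempty σ] (hS : CutsOut S x) (hS' : CutsOut S' y)
    (hxy : ConormalPair x y) (hw : ∀ i, w i ≠ 0) {p : PSpace σ} (hp : IsCriticalPoint S w p)
    (hreg : ∀ b : σ → ℂ, Specializes (Sum.elim x y) (Sum.elim p.rep b) →
      (∀ i, p.rep i * b i = w i) →
      Module.finrank ℂ (gradSpan S' b) = Module.finrank E (conormalSpace y)) :
    ∃ b, IsCriticalPoint S' w b ∧ ProductRel w p b := by
  have := hxy.essFiniteType
  obtain ⟨hpr, hpne, hperp⟩ := id hp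
  obtain ⟨hp1, hp2⟩ := (hS.isRegularPoint_iff p).1 hpr
  rw [perpTangent_iff, ← hS.specializes_iff_mem_gradSpan hxy hp1 hp2] at hperp
  have hmul : ∀ i, p.rep i * (w i / p.rep i) = w i := fun i => mul_div_cancel₀ _ (hpne i)
  have hb0 : (fun i => w i / p.rep i) ≠ 0 := by
    intro h0
    have i := Classical.arbitrary σ
    exact div_ne_zero (hw i) (hpne i) (congrFun h0 i)
  have hbr := (hS'.isRegularPoint_mk_iff _ hb0).2 ⟨hperp.snd, hreg _ hperp hmul⟩
  obtain ⟨a, ha, hrep⟩ := exists_mk_rep_eq _ hb0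
  have hrel : ProductRel w p (Projectivization.mk ℂ _ hb0) := by
    refine ⟨a, ha, fun i => ?_⟩
    rw [hrep, Pi.smul_apply, smul_eq_mul, mul_left_comm, hmul]
  exact ⟨_, (isCriticalPoint_iff_of_productRel hS hS' hxy hw hrel hpr hbr).1 hp, hrel⟩

omit [Fintype σ] in
theorem ProductRel.unique_right {p b b' : PSpace σ} (hp : ∀ i, p.rep i ≠ 0)
    (h : ProductRel w p b) (h' : ProductRel w p b') : b = b' := by
  obtain ⟨c, hc, h⟩ := h
  obtain ⟨c', hc', h'⟩ := h'
  rw [← b.mk_rep, ← b'.mk_rep, Projectivization.mk_eq_mk_iff']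
  refine ⟨c / c', ?_⟩
  ext i
  apply mul_left_cancel₀ (hp i)
  rw [h i, Pi.smul_apply, smul_eq_mul, mul_left_comm, h' i]
  field_simp

theorem exists_equiv_of_rel {α β : Type} {P : α → Prop} {Q : β → Prop} (r : α → β → Prop)
    (h1 : ∀ a, P a → ∃ b, Q b ∧ r a b) (h2 : ∀ b, Q b → ∃ a, P a ∧ r a b)
    (u1 : ∀ a b b', P a → r a b → r a b' → b = b') (u2 : ∀ a a' b, Q b → r a b → r a' b → a = a') :
    ∃ e : {a // P a} ≃ {b // Q b}, ∀ a b, e a = b ↔ r a.1 b.1 := by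
  choose f hf hfr using h1
  choose g hg hgr using h2
  refine ⟨⟨fun a => ⟨f a.1 a.2, hf _ _⟩, fun b => ⟨g b.1 b.2, hg _ _⟩, fun a => ?_, fun b => ?_⟩,
    fun a b => ⟨?_, fun h => ?_⟩⟩
  · exact Subtype.ext (u2 _ _ _ (hf a.1 a.2) (hgr _ _) (hfr _ _))
  · exact Subtype.ext (u1 _ _ _ (hg b.1 b.2) (hfr _ _) (hgr _ _))
  · rintro rfl
    exact hfr _ _
  · exact Subtype.ext (u1 _ _ _ a.2 (hfr _ _) h)

end CriticalPoints

/-! ### Values of the monomials -/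

section Monomials

variable {σ : Type} [Fintype σ]

theorem image2_mul_monomialValues {w : σ → ℂ} (hw : ∀ i, w i ≠ 0) (hsum : ∑ i, w i = 0)
    {p b : σ → ℂ} {c : ℂ} (hc : c ≠ 0) (h : ∀ i, p i * b i = c * w i) :
    Set.image2 (fun y z : ℂ => y * z) (monomialValues w p) (monomialValues w b) =
      monomialValues w w := by
  have hp : ∀ i, p i ≠ 0 := fun i h0 => by
    have := h i
    rw [h0, zero_mul] at this
    exact mul_ne_zero hc (hw i) this.symm
  ext z
  constructor
  · rintro ⟨_, ⟨α, hα, rfl⟩, _, ⟨β, hβ, rfl⟩, rfl⟩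
    -- Subtracting `log c` corrects the scalar in the relation and drops out of the exponent because
    -- the weights sum to zero.
    refine ⟨fun i => α i + β i - Complex.log c, fun i => ?_, ?_⟩
    · rw [Complex.exp_sub, Complex.exp_add, hα, hβ, Complex.exp_log hc, h i]
      field_simp
    · change _ * _ = _
      rw [← Complex.exp_add]
      congr 1
      simp only [mul_sub, mul_add, Finset.sum_sub_distrib, Finset.sum_add_distrib,
        ← Finset.sum_mul, hsum]
      ring
  · rintro ⟨γ, hγ, rfl⟩
    -- Principal logarithms for `p` suffice; `b` takes up the remainder of the given choice `γ`.
    refine ⟨_, ⟨fun i => Complex.log (p i), fun i => Complex.exp_log (hp i), rfl⟩, _,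
      ⟨fun i => γ i + Complex.log c - Complex.log (p i), fun i => ?_, rfl⟩, ?_⟩
    · rw [Complex.exp_sub, Complex.exp_add, hγ, Complex.exp_log hc, Complex.exp_log (hp i),
        mul_comm (w i), ← h i]
      exact mul_div_cancel_left₀ _ (hp i)
    · change _ * _ = _
      rw [← Complex.exp_add]
      congr 1
      simp only [mul_sub, mul_add, Finset.sum_sub_distrib, Finset.sum_add_distrib,
        ← Finset.sum_mul, hsum]
      ring

omit [Fintype σ] in
theorem prod_zpow_eq_zpow_sum {c : ℂ} (hc : c ≠ 0) (s : Finset σ) (m : σ → ℤ) :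
    ∏ i ∈ s, c ^ m i = c ^ ∑ i ∈ s, m i := by
  classical
  induction s using Finset.induction_on with
  | empty => simp
  | insert i s hi ih => rw [Finset.prod_insert hi, Finset.sum_insert hi, zpow_add₀ hc, ih]

theorem prod_zpow_mul_prod_zpow {w : σ → ℂ} (hsum : ∑ i, w i = 0)
    {p b : σ → ℂ} {c : ℂ} (hc : c ≠ 0) (h : ∀ i, p i * b i = c * w i) {m : σ → ℤ}
    (hm : ∀ i, w i = m i) : (∏ i, p i ^ m i) * (∏ i, b i ^ m i) = ∏ i, (m i : ℂ) ^ m i := by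
  have hm0 : ∑ i, m i = 0 := by
    have : ((∑ i, m i : ℤ) : ℂ) = 0 := by
      rw [Int.cast_sum, ← hsum]
      exact Finset.sum_congr rfl fun i _ => (hm i).symm
    exact_mod_cast this
  rw [← Finset.prod_mul_distrib]
  calc ∏ i, p i ^ m i * b i ^ m i = ∏ i, c ^ m i * (m i : ℂ) ^ m i :=
        Finset.prod_congr rfl fun i _ => by rw [← mul_zpow, h i, mul_zpow, hm i]
    _ = ∏ i, (m i : ℂ) ^ m i := by
        rw [Finset.prod_mul_distrib, prod_zpow_eq_zpow_sum hc, hm0, zpow_zero, one_mul]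

theorem sum_weights {n : ℕ} (u : Fin (n + 1) → ℂ) : ∑ i, weights u i = 0 := by
  rw [Fin.sum_univ_castSucc]
  simp [weights]

theorem weights_ne_zero {n : ℕ} {u : Fin (n + 1) → ℂ} (hu : ∀ i, u i ≠ 0) (hs : ∑ i, u i ≠ 0)
    (i : Fin (n + 2)) : weights u i ≠ 0 := by
  refine Fin.lastCases ?_ (fun i => ?_) i
  · simpa [weights] using hs
  · simpa [weights] using hu i

end Monomials

end MLDual

end

/-! ### The theorem -/

theorem corollary2p6 {n k : ℕ} (f : Fin k → MvPolynomial (Fin (n + 1)) ℂ)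
    (hhom : ∀ j, MLDual.IsHomog (f j))
    (hirr : MLDual.IsIrred (MLDual.zeroLocus (Set.range f)))
    (hred : MLDual.IsGenericallyReduced (Set.range f)) :
    -- for generic data `u` the relation is a bijection between the two sets of critical points
    (∃ G : MvPolynomial (Fin (n + 1)) ℂ, G ≠ 0 ∧
      ∀ u : Fin (n + 1) → ℂ, (∀ i, u i ≠ 0) → ∑ i, u i ≠ 0 → MvPolynomial.eval u G ≠ 0 →
        ∃ e : {p // MLDual.IsCriticalPoint (MLDual.primeEquations f) (MLDual.weights u) p} ≃
            {b // MLDual.IsCriticalPoint (MLDual.dualEquations (MLDual.primeEquations f))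
              (MLDual.weights u) b},
          ∀ p b, e p = b ↔ MLDual.ProductRel (MLDual.weights u) p.1 b.1) ∧
    -- for arbitrary data `u` the same holds for pairs of regular points
    (∀ u : Fin (n + 1) → ℂ, (∀ i, u i ≠ 0) → ∑ i, u i ≠ 0 →
      ∀ p b, MLDual.ProductRel (MLDual.weights u) p b →
        MLDual.IsRegularPoint (MLDual.primeEquations f) p →
        MLDual.IsRegularPoint (MLDual.dualEquations (MLDual.primeEquations f)) b →
        (MLDual.IsCriticalPoint (MLDual.primeEquations f) (MLDual.weights u) p ↔
          MLDual.IsCriticalPoint (MLDual.dualEquations (MLDual.primeEquations f))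
            (MLDual.weights u) b)) ∧
    -- the product of the two monomials is constant on pairs of critical points
    (∀ u : Fin (n + 1) → ℂ, (∀ i, u i ≠ 0) → ∑ i, u i ≠ 0 →
      ∀ p b, MLDual.ProductRel (MLDual.weights u) p b →
        MLDual.IsCriticalPoint (MLDual.primeEquations f) (MLDual.weights u) p →
        MLDual.IsCriticalPoint (MLDual.dualEquations (MLDual.primeEquations f))
          (MLDual.weights u) b →
        Set.image2 (fun y z : ℂ => y * z)
            (MLDual.monomialValues (MLDual.weights u) p.rep)
            (MLDual.monomialValues (MLDual.weights u) b.rep) =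
          MLDual.monomialValues (MLDual.weights u) (MLDual.weights u) ∧
        ∀ m : Fin (n + 2) → ℤ, (∀ i, MLDual.weights u i = (m i : ℂ)) →
          (∏ i, p.rep i ^ m i) * (∏ i, b.rep i ^ m i) = ∏ i, (m i : ℂ) ^ m i) := by
  open MLDual in
  have hS := isHomog_primeEquations hhom
  have hprime := isPrime_vanishingIdeal_primeEquations hhom hirr
  have hdata : ∀ {p₀}, IsRegularPoint (primeEquations f) p₀ →
      ∃ (E : Type) (_ : Field E) (_ : Algebra ℂ E) (x y : Fin (n + 2) → E),
        CutsOut (primeEquations f) x ∧ CutsOut (dualEquations (primeEquations f)) y ∧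
        ConormalPair x y ∧ gradSpan (dualEquations (primeEquations f)) y = conormalSpace y := by
    intro p₀ hp₀
    obtain ⟨E, hE1, hE2, x, y, hx, hxy⟩ := exists_conormalPair_cutsOut hS hprime hp₀
    have := hxy.essFiniteType
    -- If it were zero, every conormal vector over `p₀` would have last coordinate zero.
    have hy : y (Fin.last (n + 1)) ≠ 0 := by
      intro h0
      obtain ⟨hs, hr⟩ := (hx.isRegularPoint_iff p₀).1 hp₀
      obtain ⟨b, hb, hb0⟩ := exists_mem_gradSpan_primeEquations (f := f) p₀.rep
      have := ((hx.specializes_iff_mem_gradSpan hxy hs hr b).2 hb).snd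
        (MvPolynomial.X (Fin.last (n + 1))) (by rwa [MvPolynomial.aeval_X])
      rw [MvPolynomial.aeval_X] at this
      exact hb0 this
    exact ⟨E, hE1, hE2, x, y, hx, hx.dual hxy hp₀ hy, hxy, hx.gradSpan_dualEquations hxy hp₀ hy⟩
  refine ⟨?_, ?_, ?_⟩
  · by_cases hex : ∃ p₀, IsRegularPoint (primeEquations f) p₀
    · obtain ⟨p₀, hp₀⟩ := hex
      obtain ⟨E, _, _, x, y, hx, hy, hxy, hgen⟩ := hdata hp₀
      -- With the last coordinate omitted, the products normalized to the weights are exactly `u`,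
      -- so `G` is a condition on `u`.
      obtain ⟨G, hG, hGreg⟩ := exists_forall_finrank_eq_of_eval_ne_zero hx hy hxy hp₀ hgen
        (κ := Fin (n + 1)) Fin.castSucc (by simp) 0
      refine ⟨G, hG, fun u hu hus hGu => ?_⟩
      have hw := weights_ne_zero hu hus
      have hprod : ∀ p b : Fin (n + 2) → ℂ, (∀ i, p i * b i = weights u i) →
          p 0 ≠ 0 ∧
            MvPolynomial.eval (fun k : Fin (n + 1) => p k.castSucc * b k.castSucc) G ≠ 0 := by
        intro p b h
        refine ⟨fun h0 => hw 0 (by rw [← h, h0, zero_mul]), ?_⟩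
        have : (fun k : Fin (n + 1) => p k.castSucc * b k.castSucc) = u := by
          funext k
          rw [h]
          simp [weights]
        rwa [this]
      refine exists_equiv_of_rel (ProductRel (weights u)) (fun p hp => ?_) (fun b hb => ?_)
        (fun p b b' hp h h' => h.unique_right hp.2.1 h')
        (fun p p' b hb h h' => h.symm.unique_right hb.2.1 h'.symm)
      · refine hp.exists_productRel hx hy hxy hw fun b hs hm => ?_
        obtain ⟨h1, h2⟩ := hprod _ _ hm
        exact (hGreg _ _ hs h1 h2).2
      · obtain ⟨p, hp, hrel⟩ := hb.exists_productRel hy hx hxy.symm hw fun p hs hm => by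
          obtain ⟨h1, h2⟩ := hprod p b.rep fun i => by rw [mul_comm, hm]
          exact (hGreg _ _ (specializes_sumElim_swap.1 hs) h1 h2).1
        exact ⟨p, hp, hrel.symm⟩
    · push Not at hex
      -- Without regular points, `1` is an equation of the dual variety and both sets of critical
      -- points are empty.
      refine ⟨1, one_ne_zero, fun u _ _ _ => ?_⟩
      refine exists_equiv_of_rel (ProductRel (weights u)) (fun p hp => absurd hp.1 (hex p))
        (fun b hb => ?_) (fun p b b' hp h h' => h.unique_right hp.2.1 h')
        (fun p p' b hb h h' => h.symm.unique_right hb.2.1 h'.symm)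
      have := hb.1.1 _ (dualEquations_eq_of_forall_not_isRegularPoint hex)
      simp at this
  · intro u hu hus p b h hp hb
    obtain ⟨E, _, _, x, y, hx, hy, hxy, -⟩ := hdata hp
    exact isCriticalPoint_iff_of_productRel hx hy hxy (weights_ne_zero hu hus) h hp hb
  · rintro u hu hus p b ⟨c, hc, h⟩ - -
    exact ⟨image2_mul_monomialValues (weights_ne_zero hu hus) (sum_weights u) hc h,
      fun m hm => prod_zpow_mul_prod_zpow (sum_weights u) hc h hm⟩
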